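/- Let $d\ge 1$, $\Theta=[\theta_{\inf},\theta_{\sup}]^p\subset\mathbb{R}^p$, and let $\{K_\theta:\theta\in\Theta\}$ be a family of stationary covariance functions on $\mathbb{R}^d$ (that is, $(s,t)\mapsto K_\theta(s-t)$ is symmetric and positive semidefinite) such that: (i) all partial derivatives of $K_\theta(t)$ with respect to $\theta$ up to order three exist on $\Theta$ (one-sided on the boundary), and for all $0\le q\le 3$ and $i_1,\dots,i_q\in\{1,\dots,p\}$ there is $C_{i_1,\dots,i_q}<\infty$ with $$\left|\frac{\partial}{\partial\theta_{i_1}}\cdots\frac{\partial}{\partial\theta_{i_q}}K_\theta(t)\right|\le \frac{C_{i_1,\dots,i_q}}{1+|t|^{d+1}}\qquad\text{for all }\theta\in\Theta,\ t\in\mathbb{R}^d,$$ where $|t|$ is the Euclidean norm; (ii) for every $\theta\in\Theta$, $K_\theta$ and $\hat K_\theta(f)=(2\pi)^{-d}\int_{\mathbb{R}^d}K_\theta(t)e^{-\mathrm{i}f\cdot t}\,dt$ are integrable and $K_\theta(t)=\int_{\mathbb{R}^d}\hat K_\theta(f)e^{\mathrm{i}f\cdot t}\,df$ for all $t\in\mathbb{R}^d$;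 (iii) $(f,\theta)\mapsto\hat K_\theta(f)$ is real-valued, continuous and positive on $\mathbb{R}^d\times\Theta$. Let $\theta_0$ satisfy $\theta_{\inf}<(\theta_0)_i<\theta_{\sup}$ for $1\le i\le p$, and let $Y$ be a centered Gaussian process on $\mathbb{R}^d$ with covariance function $K_{\theta_0}$, defined on a probability space $(\Omega_Y,P_Y)$. Let $(v_i)_{i\ge1}$ be a deterministic sequence in $\{1,2,\dots\}^d$ with $\{v_i:1\le i\le N^d\}=\{1,\dots,N\}^d$ for all $N\ge1$, and let $\epsilon\in[0,\tfrac12)$. Let $\mathcal{L}_X$ be a symmetric probability distribution on $\mathbb{R}^d$ with (closed) support $S_X\subset[-1,1]^d$ and with a Lebesgue density that is positive on $S_X$, and let $(X_i)_{i\ge1}$ be i.i.d. with law $\mathcal{L}_X$ on a probability space $(\Omega_X,P_X)$. On the product space $(\Omega_X\times\Omega_Y,P_X\times P_Y)$, let $y=(Y(v_i+\epsilon X_i))_{1\le i\le n}$, assumed to be a random vector for every $n$, and let $R_\theta$ be the $n\times n$ matrix with entries $K_\theta(v_i-v_j+\epsilon(X_i-X_j))$. Let $$L_\theta=\frac1n\left\{\log\det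 R_\theta+y^{t}R_\theta^{-1}y\right\}$$ and let $\hat\theta_{ML}=\hat\theta_{ML}(n)$ be any choice of a global minimizer of $\theta\mapsto L_\theta$ over $\Theta$ (almost surely, for each $n\ge1$). Say that the ML estimator is consistent if every such $\hat\theta_{ML}$ converges to $\theta_0$ in $P_X\times P_Y$-probability as $n\to\infty$. (a) For $\epsilon=0$: if there does not exist $\theta\in\Theta$, $\theta\ne\theta_0$, such that $K_\theta(v)=K_{\theta_0}(v)$ for all $v\in\mathbb{Z}^d$, then the ML estimator is consistent. (b) For $\epsilon\neq0$: let $C_{S_X}=\{t_1-t_2:\ t_1,t_2\in S_X\}$ and $D_\epsilon=\bigcup_{v\in\mathbb{Z}^d\setminus\{0\}}(v+\epsilon C_{S_X})$. If there does not exist $\theta\in\Theta$, $\theta\neq\theta_0$, such that $K_\theta=K_{\theta_0}$ Lebesgue-almost everywhere on $D_\epsilon$ and $K_\theta(0)=K_{\theta_0}(0)$, then the ML estimator is consistent. -/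

import Mathlib

open MeasureTheory ProbabilityTheory Filter Topology
open scoped Pointwise

namespace PerturbedGrid

noncomputable section

/-- The parameter set `Θ = [a, b]^p`. -/
def paramSet (p : ℕ) (a b : ℝ) : Set (Fin p → ℝ) := Set.Icc (fun _ => a) (fun _ => b)

/-- The partial derivative of `g` with respect to the `i`-th parameter, on the cube `[a, b]^p`
(one-sided on the faces of the cube). -/
def paramPartial {p : ℕ} (a b : ℝ) (i : Fin p) (g : (Fin p → ℝ) → ℝ) (θ : Fin p → ℝ) : ℝ :=
  derivWithin (fun s => g (Function.update θ i s)) (Set.Icc a b) (θ i)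

/-- Iterated partial derivatives: for `I = [i₁, …, i_q]` this is `∂/∂θ_{i₁} ⋯ ∂/∂θ_{i_q} g`. -/
def iterParamPartial {p : ℕ} (a b : ℝ) :
    List (Fin p) → ((Fin p → ℝ) → ℝ) → (Fin p → ℝ) → ℝ
  | [], g => g
  | i :: I, g => paramPartial a b i (iterParamPartial a b I g)

/-- `k` is a stationary covariance function on `ℝ^d`: the kernel `(s, t) ↦ k (s - t)` is symmetric
and positive semidefinite. -/
def IsStationaryCovariance {d : ℕ} (k : EuclideanSpace ℝ (Fin d) → ℝ) : Prop :=
  ∀ (n : ℕ) (x : Fin n → EuclideanSpace ℝ (Fin d)),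
    (Matrix.of fun i j => k (x i - x j)).PosSemidef

/-- The Fourier transform `ĥ(f) = (2π)^{-d} ∫ h(t) e^{-i f·t} dt`. -/
def fourierTransform {d : ℕ} (h : EuclideanSpace ℝ (Fin d) → ℝ)
    (f : EuclideanSpace ℝ (Fin d)) : ℂ :=
  (((2 * Real.pi) ^ d)⁻¹ : ℝ) *
    ∫ t, (h t : ℂ) * Complex.exp (-(Complex.I * (inner ℝ f t : ℝ)))

/-- The regularity condition on the parametric model `{K_θ, θ ∈ Θ}`, `Θ = [a, b]^p`, of
stationary covariance functions on `ℝ^d`. -/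
structure RegularModel {d p : ℕ} (a b : ℝ)
    (K : (Fin p → ℝ) → EuclideanSpace ℝ (Fin d) → ℝ) : Prop where
  stationary : ∀ θ ∈ paramSet p a b, IsStationaryCovariance (K θ)
  /-- All partial derivatives in `θ` up to order three exist on `Θ`. -/
  differentiable : ∀ I : List (Fin p), I.length < 3 → ∀ i : Fin p, ∀ θ ∈ paramSet p a b,
    ∀ t : EuclideanSpace ℝ (Fin d), DifferentiableWithinAt ℝ
      (fun s => iterParamPartial a b I (fun θ' => K θ' t) (Function.update θ i s))
      (Set.Icc a b) (θ i)
  /-- They decay at rate `|t|^{-(d+1)}`, uniformly in `θ`. -/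
  bound : ∀ I : List (Fin p), I.length ≤ 3 → ∃ C : ℝ, ∀ θ ∈ paramSet p a b,
    ∀ t : EuclideanSpace ℝ (Fin d),
      |iterParamPartial a b I (fun θ' => K θ' t) θ| ≤ C / (1 + ‖t‖ ^ (d + 1))
  /-- The integrals defining the Fourier transform and its inverse converge absolutely. -/
  integrable : ∀ θ ∈ paramSet p a b, Integrable (K θ)
  integrable_fourier : ∀ θ ∈ paramSet p a b, Integrable (fourierTransform (K θ))
  /-- Fourier inversion holds pointwise. -/
  inversion : ∀ θ ∈ paramSet p a b, ∀ t : EuclideanSpace ℝ (Fin d),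
    (K θ t : ℂ) =
      ∫ f, fourierTransform (K θ) f * Complex.exp (Complex.I * (inner ℝ f t : ℝ))
  /-- `(f, θ) ↦ K̂_θ(f)` is jointly continuous. -/
  fourier_continuous : ContinuousOn
    (fun q : EuclideanSpace ℝ (Fin d) × (Fin p → ℝ) => fourierTransform (K q.2) q.1)
    (Set.univ ×ˢ paramSet p a b)
  /-- `K̂_θ` is real and positive. -/
  fourier_pos : ∀ θ ∈ paramSet p a b, ∀ f : EuclideanSpace ℝ (Fin d),
    0 < (fourierTransform (K θ) f).re ∧ (fourierTransform (K θ) f).im = 0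

/-- The point of `ℝ^d` with the given integer coordinates. -/
def latticePoint {d : ℕ} (u : Fin d → ℤ) : EuclideanSpace ℝ (Fin d) :=
  WithLp.toLp 2 fun k => (u k : ℝ)

/-- `v` enumerates `(ℕ*)^d` along growing cubes: for every `N ≥ 1` its first `N ^ d` terms (indexed
by `0, …, N ^ d - 1`) are exactly the points of `{1, …, N}^d`. -/
def IsGridSequence {d : ℕ} (v : ℕ → Fin d → ℤ) : Prop :=
  ∀ N : ℕ, 1 ≤ N → v '' Set.Iio (N ^ d) = {u | ∀ k, 1 ≤ u k ∧ u k ≤ (N : ℤ)}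

/-- `L` is a symmetric probability distribution whose (closed topological) support `S_X` lies in
`[-1, 1]^d`, with a Lebesgue density that is positive on `S_X`. -/
structure IsPerturbationLaw {d : ℕ} (L : Measure (EuclideanSpace ℝ (Fin d))) : Prop where
  prob : IsProbabilityMeasure L
  symm : L.map (fun t => -t) = L
  support_subset : L.support ⊆ {t | ∀ k, -1 ≤ t k ∧ t k ≤ 1}
  density : ∃ f : EuclideanSpace ℝ (Fin d) → ENNReal, Measurable f ∧
    L = volume.withDensity f ∧ ∀ t ∈ L.support, 0 < f t

/-- The observation points `v_i + ε x_i`. -/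
def obsPoint {d : ℕ} (v : ℕ → Fin d → ℤ) (ε : ℝ) (x : ℕ → EuclideanSpace ℝ (Fin d)) (i : ℕ) :
    EuclideanSpace ℝ (Fin d) :=
  latticePoint (v i) + ε • x i

/-- The `n × n` matrix `R_θ = (k(v_i - v_j + ε (x_i - x_j)))_{i,j}`, for `k = K_θ`. -/
def covMatrix {d : ℕ} (k : EuclideanSpace ℝ (Fin d) → ℝ) (v : ℕ → Fin d → ℤ) (ε : ℝ)
    (x : ℕ → EuclideanSpace ℝ (Fin d)) (n : ℕ) : Matrix (Fin n) (Fin n) ℝ :=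
  Matrix.of fun i j => k (obsPoint v ε x i - obsPoint v ε x j)

/-- The modified opposite log-likelihood `(1/n) (log det R + yᵗ R⁻¹ y)`. -/
def negLogLik {n : ℕ} (R : Matrix (Fin n) (Fin n) ℝ) (y : Fin n → ℝ) : ℝ :=
  (1 / (n : ℝ)) * (Real.log R.det + y ⬝ᵥ (R⁻¹.mulVec y))

/-- The observation vector `y = (Y(v_i + ε X_i))_{i < n}` on the product space. -/
def obs {d : ℕ} {ΩX ΩY : Type*} (v : ℕ → Fin d → ℤ) (ε : ℝ)
    (X : ℕ → ΩX → EuclideanSpace ℝ (Fin d)) (Y : EuclideanSpace ℝ (Fin d) → ΩY → ℝ)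
    (n : ℕ) (ω : ΩX × ΩY) : Fin n → ℝ :=
  fun i => Y (obsPoint v ε (fun j => X j ω.1) i) ω.2

/-- `T` is a maximum likelihood estimator: for every sample size `n ≥ 1`, almost surely, `T n` is a
global minimizer over `Θ` of the modified opposite log-likelihood of the first `n` observations. -/
def IsMLEstimator {d p : ℕ} {ΩX ΩY : Type*} [MeasurableSpace ΩX] [MeasurableSpace ΩY]
    (P : Measure (ΩX × ΩY)) (a b : ℝ) (K : (Fin p → ℝ) → EuclideanSpace ℝ (Fin d) → ℝ)
    (v : ℕ → Fin d → ℤ) (ε : ℝ) (X : ℕ → ΩX → EuclideanSpace ℝ (Fin d))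
    (Y : EuclideanSpace ℝ (Fin d) → ΩY → ℝ) (T : ℕ → ΩX × ΩY → Fin p → ℝ) : Prop :=
  ∀ n : ℕ, 1 ≤ n → ∀ᵐ ω ∂P, T n ω ∈ paramSet p a b ∧
    ∀ θ ∈ paramSet p a b,
      negLogLik (covMatrix (K (T n ω)) v ε (fun j => X j ω.1) n) (obs v ε X Y n ω) ≤
        negLogLik (covMatrix (K θ) v ε (fun j => X j ω.1) n) (obs v ε X Y n ω)

/-- `D_ε = ⋃_{v ∈ ℤ^d, v ≠ 0} (v + ε C_S)`, with `C_S = S - S` the set of differences of two points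
of `S`. -/
def diffSet {d : ℕ} (S : Set (EuclideanSpace ℝ (Fin d))) (ε : ℝ) :
    Set (EuclideanSpace ℝ (Fin d)) :=
  ⋃ u ∈ {u : Fin d → ℤ | u ≠ 0}, (latticePoint u +ᵥ ε • (S - S))

end

end PerturbedGrid

/-! The eigenvalues of the covariance matrices `R_θ` lie in a fixed interval `[c, C]` with `c > 0`:
the observation points stay separated, so the decay of `K_θ` bounds the rows of `R_θ`, while the
spectral density, positive and continuous, dominates uniformly in `θ` a multiple of a bump whose own
covariance matrix is diagonally dominant. Diagonalizing `R_{θ₀}` and `R_θ` simultaneously turns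
`L_θ - L_{θ₀}`, conditionally on the perturbations, into a weighted sum of independent chi-square
variables; its mean is at least a constant times the mean square distance `n⁻¹ ‖R_θ - R_{θ₀}‖_F²`,
so that by Chebyshev's inequality it stays positive when this distance does.

The kernels `K_θ` and `K_{θ₀}` with `θ ≠ θ₀` differ at some point of `{0} ∪ D_ε`, hence also nearby.
If that point is close to `u ∈ ℤ^d`, it is approached with positive probability by the difference of
any two observation points whose grid points differ by `u`. There are of order `n` such pairs, and
each is dependent on a bounded number of others, so the distance stays positive by the law of large
numbers. Since `L_θ` is equicontinuous in `θ` up to the bounded factor `1 + n⁻¹ |y|²`, compactness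
of `Θ` makes the gap uniform away from `θ₀`. -/

namespace PerturbedGrid

open Matrix
open scoped MatrixOrder FourierTransform

section LoewnerOrder

variable {ι : Type*}

lemma posDef_of_smul_one_le [DecidableEq ι] {R : Matrix ι ι ℝ} {c : ℝ} (hc : 0 < c)
    (h : c • (1 : Matrix ι ι ℝ) ≤ R) : R.PosDef := by
  simpa using (PosDef.one.smul hc).add_posSemidef (le_iff.1 h)

lemma le_one_add_div_smul [Finite ι] [DecidableEq ι] {R S : Matrix ι ι ℝ} {c κ : ℝ}
    (hc : 0 < c) (hκ : 0 ≤ κ) (hR : c • 1 ≤ R) (hS : S ≤ R + κ • 1) : S ≤ (1 + κ / c) • R := by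
  cases nonempty_fintype ι
  have hκR : κ • (1 : Matrix ι ι ℝ) ≤ (κ / c) • R := by
    simpa [smul_smul, hc.ne'] using
      smul_le_smul_of_nonneg_left hR (div_nonneg hκ hc.le)
  calc S ≤ R + κ • 1 := hS
    _ ≤ R + (κ / c) • R := by gcongr
    _ = (1 + κ / c) • R := by rw [add_smul, one_smul]

variable [Fintype ι]

lemma le_iff_forall_dotProduct_mulVec_le {R S : Matrix ι ι ℝ} (hR : R.IsHermitian)
    (hS : S.IsHermitian) : R ≤ S ↔ ∀ x, x ⬝ᵥ R *ᵥ x ≤ x ⬝ᵥ S *ᵥ x := by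
  rw [le_iff, posSemidef_iff_dotProduct_mulVec]
  simp only [hS.sub hR, true_and, star_trivial, sub_mulVec, dotProduct_sub, sub_nonneg]

lemma dotProduct_mulVec_mono {R S : Matrix ι ι ℝ} (h : R ≤ S) (x : ι → ℝ) :
    x ⬝ᵥ R *ᵥ x ≤ x ⬝ᵥ S *ᵥ x := by
  have := (le_iff.1 h).dotProduct_mulVec_nonneg x
  rwa [star_trivial, sub_mulVec, dotProduct_sub, sub_nonneg] at this

variable [DecidableEq ι]

lemma le_smul_one_of_mul_self_le {P : Matrix ι ι ℝ} (hP : P.IsHermitian) {c : ℝ} (hc : 0 < c)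
    (h : P * P ≤ c • P) : P ≤ c • 1 := by
  have hsq := posSemidef_conjTranspose_mul_self (c • (1 : Matrix ι ι ℝ) - P)
  rw [((isHermitian_one.smul (IsSelfAdjoint.all c)).sub hP).eq] at hsq
  have key : c • (1 : Matrix ι ι ℝ) - P =
      c⁻¹ • ((c • 1 - P) * (c • 1 - P) + (c • P - P * P)) := by
    rw [eq_inv_smul_iff₀ hc.ne']
    simp [sub_mul, mul_sub, smul_sub]
  rw [le_iff, key]
  exact (hsq.add (le_iff.1 h)).smul (inv_nonneg.2 hc.le)

lemma transpose_mul_self_le_smul_one {A : Matrix ι ι ℝ} {c : ℝ} (hc : 0 < c)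
    (h : A * Aᵀ ≤ c • 1) : Aᵀ * A ≤ c • 1 := by
  refine le_smul_one_of_mul_self_le (isHermitian_conjTranspose_mul_self A) hc ?_
  simpa [star_eq_conjTranspose, conjTranspose_eq_transpose_of_trivial, Matrix.mul_assoc] using
    star_left_conjugate_le_conjugate h A

lemma inv_le_inv_smul_one {R : Matrix ι ι ℝ} {c : ℝ} (hc : 0 < c) (h : c • 1 ≤ R) :
    R⁻¹ ≤ c⁻¹ • 1 := by
  have hR : R.PosDef := posDef_of_smul_one_le hc h
  have hinv : IsSelfAdjoint R⁻¹ := hR.inv.isHermitian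
  have hconj : c • (R⁻¹ * R⁻¹) ≤ R⁻¹ := by
    simpa [Matrix.nonsing_inv_mul _ ((isUnit_iff_isUnit_det _).1 hR.isUnit)] using
      hinv.conjugate_le_conjugate h
  refine le_smul_one_of_mul_self_le hR.inv.isHermitian (inv_pos.2 hc) ?_
  simpa [smul_smul, hc.ne'] using smul_le_smul_of_nonneg_left hconj (inv_nonneg.2 hc.le)

lemma sum_sq_mul_le {A : Matrix ι ι ℝ} {c : ℝ} (hc : 0 < c) (h : A * Aᵀ ≤ c • 1)
    (M : Matrix ι ι ℝ) : ∑ i, ∑ j, (A * M) i j ^ 2 ≤ c * ∑ i, ∑ j, M i j ^ 2 := by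
  have hsq (N : Matrix ι ι ℝ) : ∑ i, ∑ j, N i j ^ 2 = (Nᵀ * N).trace := by
    rw [Finset.sum_comm]
    simp only [trace, diag_apply, mul_apply, transpose_apply, sq]
  have hconj := star_left_conjugate_le_conjugate (transpose_mul_self_le_smul_one hc h) M
  have := (le_iff.1 hconj).trace_nonneg
  rw [trace_sub, sub_nonneg] at this
  simpa [hsq, star_eq_conjTranspose, conjTranspose_eq_transpose_of_trivial, Matrix.mul_assoc]
    using this

lemma sum_sq_congruence_le {A : Matrix ι ι ℝ} {c : ℝ} (hc : 0 < c) (h : A * Aᵀ ≤ c • 1)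
    (D : Matrix ι ι ℝ) :
    ∑ i, ∑ j, (A * D * Aᵀ) i j ^ 2 ≤ c ^ 2 * ∑ i, ∑ j, D i j ^ 2 := by
  have hT (M : Matrix ι ι ℝ) : ∑ i, ∑ j, Mᵀ i j ^ 2 = ∑ i, ∑ j, M i j ^ 2 := Finset.sum_comm
  calc ∑ i, ∑ j, (A * D * Aᵀ) i j ^ 2 = ∑ i, ∑ j, (A * (A * D)ᵀ) i j ^ 2 := by
        rw [← hT, transpose_mul, transpose_transpose]
    _ ≤ c * ∑ i, ∑ j, (A * D) i j ^ 2 := by rw [← hT (A * D)]; exact sum_sq_mul_le hc h _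
    _ ≤ c * (c * ∑ i, ∑ j, D i j ^ 2) := by gcongr; exact sum_sq_mul_le hc h D
    _ = c ^ 2 * ∑ i, ∑ j, D i j ^ 2 := by ring

/-- `A` diagonalizes the symmetric matrices `R₀` and `R` by congruence: `R₀ = A Aᵀ` and
`R = A diag(μ) Aᵀ` with all `μ i > 0`. The `μ i` are the eigenvalues of `R₀⁻¹ R`. -/
structure CongruenceDiagonalization (A : Matrix ι ι ℝ) (μ : ι → ℝ) (R₀ R : Matrix ι ι ℝ) :
    Prop where
  isUnit : IsUnit A
  pos : ∀ i, 0 < μ i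
  left_eq : R₀ = A * Aᵀ
  right_eq : R = A * diagonal μ * Aᵀ

lemma exists_orthogonal_diagonalization {M : Matrix ι ι ℝ} (hM : M.PosDef) :
    ∃ (V : Matrix ι ι ℝ) (μ : ι → ℝ), (∀ i, 0 < μ i) ∧ V * Vᵀ = 1 ∧ M = V * diagonal μ * Vᵀ := by
  refine ⟨hM.1.eigenvectorUnitary, hM.1.eigenvalues, hM.eigenvalues_pos, ?_, ?_⟩
  · simpa [star_eq_conjTranspose, conjTranspose_eq_transpose_of_trivial] using
      Unitary.coe_mul_star_self hM.1.eigenvectorUnitary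
  · simpa [Unitary.conjStarAlgAut_apply, star_eq_conjTranspose,
      conjTranspose_eq_transpose_of_trivial] using hM.1.spectral_theorem

lemma exists_congruenceDiagonalization {R₀ R : Matrix ι ι ℝ} (h₀ : R₀.PosDef) (h : R.PosDef) :
    ∃ A μ, CongruenceDiagonalization A μ R₀ R := by
  set S := CFC.sqrt R₀
  have hSS : S * S = R₀ := CFC.sqrt_mul_sqrt_self R₀ h₀.posSemidef.nonneg
  have hSt : Sᵀ = S := by
    rw [← conjTranspose_eq_transpose_of_trivial]
    exact (nonneg_iff_posSemidef.1 (CFC.sqrt_nonneg R₀)).isHermitian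
  have hS : IsUnit S := isUnit_of_mul_isUnit_left (hSS ▸ h₀.isUnit)
  have hSdet : IsUnit S.det := (isUnit_iff_isUnit_det S).1 hS
  have hM : (S⁻¹ * R * S⁻¹).PosDef := by
    have := (IsUnit.posDef_star_right_conjugate_iff (isUnit_nonsing_inv_iff.2 hS)).2 h
    rwa [star_eq_conjTranspose, conjTranspose_eq_transpose_of_trivial, transpose_nonsing_inv,
      hSt] at this
  obtain ⟨V, μ, hμ, hV, hVM⟩ := exists_orthogonal_diagonalization hM
  refine ⟨S * V, μ, hS.mul (.of_mul_eq_one _ hV), hμ, ?_, ?_⟩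
  · rw [transpose_mul, hSt, Matrix.mul_assoc, ← Matrix.mul_assoc V, hV, Matrix.one_mul, hSS]
  · calc R = S * (S⁻¹ * R * S⁻¹) * S := by
          rw [Matrix.mul_assoc S⁻¹, mul_nonsing_inv_cancel_left _ _ hSdet,
            nonsing_inv_mul_cancel_right _ _ hSdet]
      _ = S * V * diagonal μ * (S * V)ᵀ := by
          rw [hVM, transpose_mul, hSt]; simp only [Matrix.mul_assoc]

namespace CongruenceDiagonalization

variable {A R₀ R : Matrix ι ι ℝ} {μ : ι → ℝ}

lemma le_smul_iff (h : CongruenceDiagonalization A μ R₀ R) {r : ℝ} :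
    R ≤ r • R₀ ↔ ∀ i, μ i ≤ r := by
  have key : r • R₀ - R = A * diagonal (fun i => r - μ i) * star A := by
    rw [star_eq_conjTranspose, conjTranspose_eq_transpose_of_trivial, h.left_eq, h.right_eq,
      ← diagonal_sub, mul_sub, sub_mul, ← smul_one_eq_diagonal]
    simp
  rw [le_iff, key, h.isUnit.posSemidef_star_right_conjugate_iff, posSemidef_diagonal_iff]
  simp only [sub_nonneg]

lemma smul_le_iff (h : CongruenceDiagonalization A μ R₀ R) {r : ℝ} :
    r • R₀ ≤ R ↔ ∀ i, r ≤ μ i := by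
  have key : R - r • R₀ = A * diagonal (fun i => μ i - r) * star A := by
    rw [star_eq_conjTranspose, conjTranspose_eq_transpose_of_trivial, h.left_eq, h.right_eq,
      ← diagonal_sub, mul_sub, sub_mul, ← smul_one_eq_diagonal]
    simp
  rw [le_iff, key, h.isUnit.posSemidef_star_right_conjugate_iff, posSemidef_diagonal_iff]
  simp only [sub_nonneg]

lemma inv_right_eq (h : CongruenceDiagonalization A μ R₀ R) :
    R⁻¹ = (A⁻¹)ᵀ * diagonal (fun i => (μ i)⁻¹) * A⁻¹ := by
  have hinv : (diagonal μ)⁻¹ = diagonal fun i => (μ i)⁻¹ :=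
    inv_eq_right_inv (by simp [(h.pos _).ne'])
  rw [h.right_eq, Matrix.mul_inv_rev, Matrix.mul_inv_rev, transpose_nonsing_inv, hinv,
    Matrix.mul_assoc]

lemma dotProduct_inv_right_mulVec (h : CongruenceDiagonalization A μ R₀ R) (y : ι → ℝ) :
    y ⬝ᵥ R⁻¹ *ᵥ y = ∑ i, (μ i)⁻¹ * (A⁻¹ *ᵥ y) i ^ 2 := by
  rw [h.inv_right_eq, ← mulVec_mulVec, ← mulVec_mulVec, dotProduct_mulVec, vecMul_transpose]
  simp only [dotProduct, mulVec_diagonal]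
  exact Finset.sum_congr rfl fun i _ => by ring

lemma dotProduct_inv_left_mulVec (h : CongruenceDiagonalization A μ R₀ R) (y : ι → ℝ) :
    y ⬝ᵥ R₀⁻¹ *ᵥ y = ∑ i, (A⁻¹ *ᵥ y) i ^ 2 := by
  rw [h.left_eq, Matrix.mul_inv_rev, ← mulVec_mulVec, dotProduct_mulVec, ← transpose_nonsing_inv,
    vecMul_transpose]
  simp only [dotProduct, sq]

lemma log_det_right (h : CongruenceDiagonalization A μ R₀ R) :
    Real.log R.det = Real.log R₀.det + ∑ i, Real.log (μ i) := by
  have hA : A.det ≠ 0 := ((isUnit_iff_isUnit_det A).1 h.isUnit).ne_zero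
  rw [h.right_eq, h.left_eq, det_mul_right_comm, det_mul, det_diagonal,
    Real.log_mul (by simp [hA]) (Finset.prod_ne_zero_iff.2 fun i _ => (h.pos i).ne'),
    Real.log_prod fun i _ => (h.pos i).ne']

end CongruenceDiagonalization

lemma negLogLik_sub_eq {n : ℕ} {A R₀ R : Matrix (Fin n) (Fin n) ℝ} {μ : Fin n → ℝ}
    (h : CongruenceDiagonalization A μ R₀ R) (y : Fin n → ℝ) :
    negLogLik R y - negLogLik R₀ y =
      (1 / (n : ℝ)) * ∑ i, (Real.log (μ i) + ((μ i)⁻¹ - 1) * (A⁻¹ *ᵥ y) i ^ 2) := by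
  unfold negLogLik
  rw [h.log_det_right, h.dotProduct_inv_right_mulVec, h.dotProduct_inv_left_mulVec, ← mul_sub]
  simp only [Finset.sum_add_distrib, sub_mul, Finset.sum_sub_distrib, one_mul]
  ring

lemma negLogLik_sub_le {n : ℕ} (hn : 0 < n) {R' R : Matrix (Fin n) (Fin n) ℝ} {c κ : ℝ}
    (hc : 0 < c) (hκ : 0 ≤ κ) (hR : c • 1 ≤ R) (hR' : c • 1 ≤ R') (h : R' ≤ R + κ • 1)
    (h' : R ≤ R' + κ • 1) (y : Fin n → ℝ) :
    negLogLik R' y - negLogLik R y ≤ κ / c + κ / c ^ 2 * ((1 / (n : ℝ)) * (y ⬝ᵥ y)) := by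
  obtain ⟨A, μ, hA⟩ := exists_congruenceDiagonalization (posDef_of_smul_one_le hc hR)
    (posDef_of_smul_one_le hc hR')
  have : 0 ≤ κ / c := by positivity
  have hμ : ∀ i, μ i ≤ 1 + κ / c := hA.le_smul_iff.1 (le_one_add_div_smul hc hκ hR h)
  have hμinv : ∀ i, (μ i)⁻¹ ≤ 1 + κ / c := by
    have hsmul : (1 + κ / c)⁻¹ • R ≤ R' := by
      rw [inv_smul_le_iff_of_pos (by positivity)]
      exact le_one_add_div_smul hc hκ hR' h'
    exact fun i => inv_le_of_inv_le₀ (by positivity) (hA.smul_le_iff.1 hsmul i)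
  have hz : ∑ i, (A⁻¹ *ᵥ y) i ^ 2 ≤ c⁻¹ * (y ⬝ᵥ y) := by
    have := dotProduct_mulVec_mono (inv_le_inv_smul_one hc hR) y
    rwa [hA.dotProduct_inv_left_mulVec, smul_mulVec, one_mulVec, dotProduct_smul,
      smul_eq_mul] at this
  have : (0 : ℝ) < n := by exact_mod_cast hn
  rw [negLogLik_sub_eq hA]
  calc (1 / (n : ℝ)) * ∑ i, (Real.log (μ i) + ((μ i)⁻¹ - 1) * (A⁻¹ *ᵥ y) i ^ 2)
      ≤ (1 / (n : ℝ)) * ∑ i, (κ / c + κ / c * (A⁻¹ *ᵥ y) i ^ 2) := by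
        gcongr with i
        · linarith [Real.log_le_sub_one_of_pos (hA.pos i), hμ i]
        · linarith [hμinv i]
    _ = κ / c + κ / c * ((1 / (n : ℝ)) * ∑ i, (A⁻¹ *ᵥ y) i ^ 2) := by
        rw [Finset.sum_add_distrib, ← Finset.mul_sum]
        simp only [Finset.sum_const, Finset.card_univ, Fintype.card_fin, nsmul_eq_mul]
        field_simp
    _ ≤ κ / c + κ / c * ((1 / (n : ℝ)) * (c⁻¹ * (y ⬝ᵥ y))) := by gcongr
    _ = κ / c + κ / c ^ 2 * ((1 / (n : ℝ)) * (y ⬝ᵥ y)) := by field_simp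

end LoewnerOrder

section Probability

variable {Ω : Type*} [MeasurableSpace Ω] {P : Measure Ω} {ι κ : Type*}

lemma measure_le_half_le_of_le_integral [IsFiniteMeasure P] {Z : Ω → ℝ} (hZ : MemLp Z 2 P)
    {m V : ℝ} (hm : 0 < m) (hE : m ≤ P[Z]) (hV : Var[Z; P] ≤ V) :
    P {ω | Z ω ≤ m / 2} ≤ ENNReal.ofReal (4 * V / m ^ 2) := by
  calc P {ω | Z ω ≤ m / 2} ≤ P {ω | m / 2 ≤ |Z ω - P[Z]|} := by
        refine measure_mono fun ω (hω : Z ω ≤ m / 2) => ?_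
        rw [Set.mem_ofPred_eq, abs_sub_comm]
        exact le_trans (by linarith) (le_abs_self _)
    _ ≤ ENNReal.ofReal (Var[Z; P] / (m / 2) ^ 2) := meas_ge_le_variance_div_sq hZ (by positivity)
    _ ≤ ENNReal.ofReal (V / (m / 2) ^ 2) := by gcongr
    _ = ENNReal.ofReal (4 * V / m ^ 2) := by congr 1; field_simp; norm_num

lemma memLp_two_sq_gaussianReal : MemLp (fun x : ℝ => x ^ 2) 2 (gaussianReal 0 1) := by
  have h4 : MemLp (fun x : ℝ => x) 4 (gaussianReal 0 1) := memLp_id_gaussianReal 4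
  rw [memLp_two_iff_integrable_sq (by fun_prop)]
  refine (h4.integrable_norm_pow (p := 4) (by norm_num)).congr (ae_of_all _ fun x => ?_)
  simp only [Real.norm_eq_abs, ← pow_mul, Nat.reduceMul]
  exact Even.pow_abs (by decide) x

lemma integral_sq_gaussianReal : ∫ x : ℝ, x ^ 2 ∂gaussianReal 0 1 = 1 := by
  have := variance_of_integral_eq_zero (μ := gaussianReal 0 1) (X := id) (by fun_prop)
    integral_id_gaussianReal
  simpa [variance_id_gaussianReal] using this.symm

/-- The variance of the square of a standard Gaussian variable. -/
noncomputable def sqGaussianVariance : ℝ := Var[fun x : ℝ => x ^ 2; gaussianReal 0 1]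

section WeightedChiSquare

variable {w : ι → Ω → ℝ} (hw : ∀ i, HasLaw (w i) (gaussianReal 0 1) P) (a b : ι → ℝ)

include hw

lemma memLp_two_add_mul_sq_gaussian (i : ι) : MemLp (fun ω => a i + b i * w i ω ^ 2) 2 P := by
  have hP : IsProbabilityMeasure P := (hw i).isProbabilityMeasure
  have hsq : MemLp (fun ω => w i ω ^ 2) 2 P := by
    refine MemLp.comp_of_map (g := fun x : ℝ => x ^ 2) ?_ (hw i).aemeasurable
    rw [(hw i).map_eq]
    exact memLp_two_sq_gaussianReal
  exact (memLp_const (a i)).add (hsq.const_mul (b i))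

variable [Fintype ι]

lemma integral_sum_add_mul_sq_gaussian :
    P[fun ω => ∑ i, (a i + b i * w i ω ^ 2)] = ∑ i, (a i + b i) := by
  rw [integral_finsetSum _ fun i _ => have := (hw i).isProbabilityMeasure
    (memLp_two_add_mul_sq_gaussian hw a b i).integrable (by norm_num)]
  refine Finset.sum_congr rfl fun i _ => ?_
  have := (hw i).integral_comp (f := fun x => a i + b i * x ^ 2) (by fun_prop)
  simp only [Function.comp_def] at this
  rw [this, integral_add (integrable_const _)
    ((memLp_two_sq_gaussianReal.integrable (by norm_num)).const_mul _), integral_const_mul,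
    integral_sq_gaussianReal]
  simp

lemma variance_sum_add_mul_sq_gaussian (hind : iIndepFun w P) :
    Var[fun ω => ∑ i, (a i + b i * w i ω ^ 2); P] = sqGaussianVariance * ∑ i, b i ^ 2 := by
  have hP : IsProbabilityMeasure P := hind.isProbabilityMeasure
  have hL2 := memLp_two_add_mul_sq_gaussian hw a b
  have hsum : (fun ω => ∑ i, (a i + b i * w i ω ^ 2)) = ∑ i, fun ω => a i + b i * w i ω ^ 2 := by
    ext ω; simp
  rw [hsum, IndepFun.variance_sum (fun i _ => hL2 i) fun i _ j _ hij =>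
    (hind.indepFun hij).comp (φ := fun x => a i + b i * x ^ 2) (ψ := fun x => a j + b j * x ^ 2)
      (by fun_prop) (by fun_prop), Finset.mul_sum]
  refine Finset.sum_congr rfl fun i _ => ?_
  have hmeas : AEMeasurable (fun ω => b i * w i ω ^ 2) P :=
    ((hw i).aemeasurable.pow_const 2).const_mul _
  rw [variance_const_add hmeas.aestronglyMeasurable, variance_const_mul, mul_comm,
    sqGaussianVariance, ← (hw i).map_eq, variance_map (by fun_prop) (hw i).aemeasurable]
  rfl

end WeightedChiSquare

lemma sq_sub_one_div_le_sub_log {ν D : ℝ} (hν : 0 < ν) (hD : ν ≤ D) :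
    (ν - 1) ^ 2 / (1 + √D) ^ 2 ≤ ν - 1 - Real.log ν := by
  have hs : 0 < √ν := Real.sqrt_pos.2 hν
  have hsq : √ν ^ 2 = ν := Real.sq_sqrt hν.le
  have hlog : Real.log ν ≤ 2 * (√ν - 1) := by
    have := Real.log_le_sub_one_of_pos hs
    rw [Real.log_sqrt hν.le] at this
    linarith
  rw [div_le_iff₀ (by positivity)]
  calc (ν - 1) ^ 2 = (1 - √ν) ^ 2 * (1 + √ν) ^ 2 := by nth_rw 1 [← hsq]; ring
    _ ≤ (1 - √ν) ^ 2 * (1 + √D) ^ 2 := by gcongr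
    _ ≤ (ν - 1 - Real.log ν) * (1 + √D) ^ 2 := by
        gcongr
        nlinarith

lemma measure_sum_log_sq_gaussian_le [Fintype ι] {w : ι → Ω → ℝ}
    (hw : ∀ i, HasLaw (w i) (gaussianReal 0 1) P) (hind : iIndepFun w P) {ν : ι → ℝ}
    (hν : ∀ i, 0 < ν i) {D : ℝ} (hD : ∀ i, ν i ≤ D) (hS : 0 < ∑ i, (ν i - 1) ^ 2) :
    P {ω | ∑ i, (-Real.log (ν i) + (ν i - 1) * w i ω ^ 2) ≤
        (∑ i, (ν i - 1) ^ 2) / (1 + √D) ^ 2 / 2} ≤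
      ENNReal.ofReal (4 * sqGaussianVariance * (1 + √D) ^ 4 / ∑ i, (ν i - 1) ^ 2) := by
  have hP : IsProbabilityMeasure P := hind.isProbabilityMeasure
  have hL2 : MemLp (fun ω => ∑ i, (-Real.log (ν i) + (ν i - 1) * w i ω ^ 2)) 2 P :=
    memLp_finsetSum _ fun i _ =>
      memLp_two_add_mul_sq_gaussian hw (fun i => -Real.log (ν i)) (fun i => ν i - 1) i
  refine (measure_le_half_le_of_le_integral hL2 (by positivity) ?_
    (variance_sum_add_mul_sq_gaussian hw (fun i => -Real.log (ν i)) _ hind).le).trans_eq ?_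
  · rw [integral_sum_add_mul_sq_gaussian hw (fun i => -Real.log (ν i)), Finset.sum_div]
    exact Finset.sum_le_sum fun i _ => by linarith [sq_sub_one_div_le_sub_log (hν i) (hD i)]
  · congr 1
    field_simp

/-- `y` is a centered Gaussian vector with covariance matrix `R`. -/
structure HasCenteredGaussianLaw (y : ι → Ω → ℝ) (R : Matrix ι ι ℝ) (P : Measure Ω) : Prop where
  hasGaussianLaw : HasGaussianLaw (fun ω i => y i ω) P
  integral_eq_zero : ∀ i, P[y i] = 0
  covariance_eq : ∀ i j, cov[y i, y j; P] = R i j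

namespace HasCenteredGaussianLaw

variable {y : ι → Ω → ℝ} {R : Matrix ι ι ℝ}

lemma integral_sq (h : HasCenteredGaussianLaw y R P) (i : ι) :
    ∫ ω, y i ω ^ 2 ∂P = R i i := by
  have hi := (h.hasGaussianLaw.eval i).aemeasurable
  rw [← h.covariance_eq, covariance_self hi, variance_of_integral_eq_zero hi
    (h.integral_eq_zero i)]

lemma mulVec [Fintype ι] [Finite κ] (h : HasCenteredGaussianLaw y R P)
    (B : Matrix κ ι ℝ) :
    HasCenteredGaussianLaw (fun k ω => (B *ᵥ fun i => y i ω) k) (B * R * Bᵀ) P where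
  hasGaussianLaw := by
    cases nonempty_fintype κ
    simpa using h.hasGaussianLaw.map_fun (LinearMap.toContinuousLinearMap B.mulVecLin)
  integral_eq_zero k := by
    simp only [Matrix.mulVec, dotProduct]
    rw [integral_finsetSum _ fun i _ => (h.hasGaussianLaw.eval i).integrable.const_mul _]
    simp [integral_const_mul, h.integral_eq_zero]
  covariance_eq k l := by
    have := h.hasGaussianLaw.isProbabilityMeasure
    have hL2 (i : ι) : MemLp (y i) 2 P := (h.hasGaussianLaw.eval i).memLp_two
    simp only [Matrix.mulVec, dotProduct]
    rw [covariance_fun_sum_fun_sum (fun i => (hL2 i).const_mul _) fun i => (hL2 i).const_mul _]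
    simp only [covariance_const_mul_left, covariance_const_mul_right, h.covariance_eq,
      Matrix.mul_apply, Matrix.transpose_apply, Finset.sum_mul]
    rw [Finset.sum_comm]
    exact Finset.sum_congr rfl fun i _ => Finset.sum_congr rfl fun j _ => by ring

variable [DecidableEq ι]

lemma hasLaw_gaussianReal (h : HasCenteredGaussianLaw y 1 P) (i : ι) :
    HasLaw (y i) (gaussianReal 0 1) P where
  aemeasurable := (h.hasGaussianLaw.eval i).aemeasurable
  map_eq := by
    have hi := h.hasGaussianLaw.eval i
    rw [hi.map_eq_gaussianReal, h.integral_eq_zero, ← covariance_self hi.aemeasurable,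
      h.covariance_eq]
    simp

lemma iIndepFun [Finite ι] (h : HasCenteredGaussianLaw y 1 P) : iIndepFun y P := by
  cases nonempty_fintype ι
  exact h.hasGaussianLaw.iIndepFun_of_covariance_eq_zero fun i j hij => by
    rw [h.covariance_eq, one_apply_ne hij]

lemma inv_mulVec [Fintype ι] {A : Matrix ι ι ℝ} (h : HasCenteredGaussianLaw y (A * Aᵀ) P)
    (hA : IsUnit A) : HasCenteredGaussianLaw (fun k ω => (A⁻¹ *ᵥ fun i => y i ω) k) 1 P := by
  have hdet : IsUnit A.det := (isUnit_iff_isUnit_det A).1 hA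
  have := h.mulVec A⁻¹
  rwa [nonsing_inv_mul_cancel_left _ _ hdet, ← transpose_mul, nonsing_inv_mul _ hdet,
    transpose_one] at this

end HasCenteredGaussianLaw

section LikelihoodGap

lemma CongruenceDiagonalization.sum_sq_sub_le [Fintype ι] [DecidableEq ι]
    {A R₀ R : Matrix ι ι ℝ} {μ : ι → ℝ} (h : CongruenceDiagonalization A μ R₀ R) {c D : ℝ}
    (hc : 0 < c) (hR₀ : R₀ ≤ c • 1) (hμ : ∀ i, μ i ≤ D) :
    ∑ i, ∑ j, (R i j - R₀ i j) ^ 2 ≤ c ^ 2 * D ^ 2 * ∑ i, ((μ i)⁻¹ - 1) ^ 2 := by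
  have hsub : R - R₀ = A * (diagonal fun i => μ i - 1) * Aᵀ := by
    rw [h.left_eq, h.right_eq, ← diagonal_sub, diagonal_one, Matrix.mul_sub, Matrix.sub_mul,
      Matrix.mul_one]
  have hdiag : ∑ i, ∑ j, (diagonal fun i => μ i - 1) i j ^ 2 = ∑ i, (μ i - 1) ^ 2 := by
    refine Finset.sum_congr rfl fun i _ => ?_
    simp [diagonal_apply, ite_pow]
  calc ∑ i, ∑ j, (R i j - R₀ i j) ^ 2
      ≤ c ^ 2 * ∑ i, (μ i - 1) ^ 2 := by
        simp only [← Matrix.sub_apply, hsub]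
        exact hdiag ▸ sum_sq_congruence_le hc (h.left_eq ▸ hR₀) _
    _ = c ^ 2 * ∑ i, μ i ^ 2 * ((μ i)⁻¹ - 1) ^ 2 := by
        congr 1
        refine Finset.sum_congr rfl fun i _ => ?_
        have := (h.pos i).ne'
        field_simp
        ring
    _ ≤ c ^ 2 * ∑ i, D ^ 2 * ((μ i)⁻¹ - 1) ^ 2 := by
        gcongr with i
        exacts [(h.pos i).le, hμ i]
    _ = c ^ 2 * D ^ 2 * ∑ i, ((μ i)⁻¹ - 1) ^ 2 := by rw [← Finset.mul_sum, mul_assoc]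

lemma CongruenceDiagonalization.measure_negLogLik_sub_le {n : ℕ} (hn : 0 < n)
    {A R₀ R : Matrix (Fin n) (Fin n) ℝ} {μ : Fin n → ℝ} (h : CongruenceDiagonalization A μ R₀ R)
    {y : Fin n → Ω → ℝ} (hy : HasCenteredGaussianLaw y R₀ P) {D q : ℝ} (hD : ∀ i, (μ i)⁻¹ ≤ D)
    (hq : 0 < q) (hS : q * n ≤ ∑ i, ((μ i)⁻¹ - 1) ^ 2) :
    P {ω | negLogLik R (y · ω) - negLogLik R₀ (y · ω) ≤ q / (1 + √D) ^ 2 / 2} ≤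
      ENNReal.ofReal (4 * sqGaussianVariance * (1 + √D) ^ 4 / (q * n)) := by
  have hn' : (0 : ℝ) < n := by exact_mod_cast hn
  have hz := (h.left_eq ▸ hy).inv_mulVec h.isUnit
  have hV : 0 ≤ sqGaussianVariance := variance_nonneg _ _
  refine (measure_mono fun ω hω => ?_).trans
    ((measure_sum_log_sq_gaussian_le hz.hasLaw_gaussianReal hz.iIndepFun
      (fun i => inv_pos.2 (h.pos i)) hD ((by positivity : 0 < q * n).trans_le hS)).trans ?_)
  · simp only [Set.mem_ofPred_eq] at hω ⊢
    rw [negLogLik_sub_eq h, one_div, inv_mul_le_iff₀ hn'] at hω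
    simp only [Real.log_inv, neg_neg]
    calc _ ≤ n * (q / (1 + √D) ^ 2 / 2) := hω
      _ = q * n / (1 + √D) ^ 2 / 2 := by ring
      _ ≤ _ := by gcongr
  · gcongr

lemma exists_measure_negLogLik_sub_le {c C κ : ℝ} (hc : 0 < c) (hC : 0 < C) (hκ : 0 < κ) :
    ∃ δ > 0, ∃ V : ℝ, ∀ n : ℕ, 0 < n → ∀ (y : Fin n → Ω → ℝ) (R₀ R : Matrix (Fin n) (Fin n) ℝ),
      HasCenteredGaussianLaw y R₀ P → c • 1 ≤ R₀ → c • 1 ≤ R → R₀ ≤ C • 1 → R ≤ C • 1 →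
      κ * n ≤ ∑ i, ∑ j, (R i j - R₀ i j) ^ 2 →
      P {ω | negLogLik R (y · ω) - negLogLik R₀ (y · ω) ≤ δ} ≤ ENNReal.ofReal (V / n) := by
  set q := κ / (C ^ 2 * (C / c) ^ 2)
  refine ⟨q / (1 + √(C / c)) ^ 2 / 2, by positivity,
    4 * sqGaussianVariance * (1 + √(C / c)) ^ 4 / q,
    fun n hn y R₀ R hy hR₀ hR hR₀C hRC hfar => ?_⟩
  obtain ⟨A, μ, h⟩ := exists_congruenceDiagonalization (posDef_of_smul_one_le hc hR₀)
    (posDef_of_smul_one_le hc hR)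
  have hle {S T : Matrix (Fin n) (Fin n) ℝ} (hS : c • 1 ≤ S) (hT : T ≤ C • 1) :
      T ≤ (C / c) • S := by
    refine hT.trans ?_
    simpa [smul_smul, hc.ne'] using smul_le_smul_of_nonneg_left hS (by positivity : 0 ≤ C / c)
  have hμ : ∀ i, μ i ≤ C / c := h.le_smul_iff.1 (hle hR₀ hRC)
  have hμinv : ∀ i, (μ i)⁻¹ ≤ C / c := fun i => inv_le_of_inv_le₀ (by positivity) <|
    h.smul_le_iff.1 ((inv_smul_le_iff_of_pos (by positivity)).2 (hle hR hR₀C)) i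
  rw [div_div _ q]
  refine h.measure_negLogLik_sub_le hn hy hμinv (by positivity) ?_
  rw [div_mul_eq_mul_div, div_le_iff₀' (by positivity)]
  exact hfar.trans (h.sum_sq_sub_le hC hR₀C hμ)

end LikelihoodGap

end Probability

section WeakDependence

variable {Ω ι E : Type*} [MeasurableSpace Ω] {P : Measure Ω} [MeasurableSpace E] {L : Measure E}

lemma memLp_of_mem_Icc_zero_one [IsFiniteMeasure P] {Z : Ω → ℝ} (hZ : AEMeasurable Z P)
    (h01 : ∀ ω, Z ω ∈ Set.Icc (0 : ℝ) 1) (q : ENNReal) : MemLp Z q P :=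
  MemLp.of_bound hZ.aestronglyMeasurable 1 <| ae_of_all _ fun ω => by
    rw [Real.norm_of_nonneg (h01 ω).1]
    exact (h01 ω).2

variable [IsProbabilityMeasure P]

lemma covariance_le_one {Z W : Ω → ℝ} (hZ : AEMeasurable Z P) (hW : AEMeasurable W P)
    (hZ01 : ∀ ω, Z ω ∈ Set.Icc (0 : ℝ) 1) (hW01 : ∀ ω, W ω ∈ Set.Icc (0 : ℝ) 1) :
    cov[Z, W; P] ≤ 1 := by
  have hZL := memLp_of_mem_Icc_zero_one hZ hZ01 2
  have hWL := memLp_of_mem_Icc_zero_one hW hW01 2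
  have hprod : P[Z * W] ≤ ∫ _, (1 : ℝ) ∂P :=
    integral_mono (hZL.integrable_mul hWL) (integrable_const _)
      fun ω => mul_le_one₀ (hZ01 ω).2 (hW01 ω).1 (hW01 ω).2
  have hmean : 0 ≤ P[Z] * P[W] :=
    mul_nonneg (integral_nonneg fun ω => (hZ01 ω).1) (integral_nonneg fun ω => (hW01 ω).1)
  rw [covariance_eq_sub hZL hWL]
  simp only [integral_const, probReal_univ, smul_eq_mul, mul_one] at hprod
  linarith

lemma variance_sum_le_of_card_filter_le {Z : ι → Ω → ℝ} (hZ : ∀ i, AEMeasurable (Z i) P)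
    (h01 : ∀ i ω, Z i ω ∈ Set.Icc (0 : ℝ) 1) {J : Finset ι} {r : ι → ι → Prop}
    [DecidableRel r] (hr : ∀ i ∈ J, ∀ j ∈ J, ¬ r i j → cov[Z i, Z j; P] = 0) {m : ℕ}
    (hm : ∀ i ∈ J, {j ∈ J | r i j}.card ≤ m) :
    Var[fun ω => ∑ i ∈ J, Z i ω; P] ≤ m * J.card := by
  have hrow : ∀ i ∈ J, ∑ j ∈ J, cov[Z i, Z j; P] ≤ m := fun i hi => by
    calc ∑ j ∈ J, cov[Z i, Z j; P] ≤ ∑ j ∈ J, if r i j then 1 else 0 := by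
          refine Finset.sum_le_sum fun j hj => ?_
          split_ifs with h
          · exact covariance_le_one (hZ i) (hZ j) (h01 i) (h01 j)
          · exact (hr i hi j hj h).le
      _ = {j ∈ J | r i j}.card := Finset.sum_boole _ _
      _ ≤ m := by exact_mod_cast hm i hi
  rw [variance_fun_sum' fun i _ => memLp_of_mem_Icc_zero_one (hZ i) (h01 i) 2]
  exact (Finset.sum_le_card_nsmul _ _ _ hrow).trans_eq (by rw [nsmul_eq_mul, mul_comm])

variable {X : ι → Ω → E}

lemma covariance_pair_eq_zero (hX : ∀ i, HasLaw (X i) L P) (hind : iIndepFun X P)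
    {f : E × E → ℝ} (hf : Measurable f) (hf01 : ∀ z, f z ∈ Set.Icc (0 : ℝ) 1) {q r : ι × ι}
    (h : ¬ (q.1 = r.1 ∨ q.1 = r.2 ∨ q.2 = r.1 ∨ q.2 = r.2)) :
    cov[fun ω => f (X q.1 ω, X q.2 ω), fun ω => f (X r.1 ω, X r.2 ω); P] = 0 := by
  push Not at h
  have hm (s : ι × ι) : AEMeasurable (fun ω => f (X s.1 ω, X s.2 ω)) P :=
    hf.comp_aemeasurable ((hX s.1).aemeasurable.prodMk (hX s.2).aemeasurable)
  have hindep := hind.indepFun_prodMk_prodMk₀ (fun i => (hX i).aemeasurable) q.1 q.2 r.1 r.2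
    h.1 h.2.1 h.2.2.1 h.2.2.2
  exact (hindep.comp hf hf).covariance_eq_zero
    (memLp_of_mem_Icc_zero_one (hm q) (fun _ => hf01 _) 2)
    (memLp_of_mem_Icc_zero_one (hm r) (fun _ => hf01 _) 2)

lemma card_filter_sharing_le [DecidableEq ι] {J : Finset (ι × ι)}
    (hfst : Set.InjOn Prod.fst (J : Set (ι × ι))) (hsnd : Set.InjOn Prod.snd (J : Set (ι × ι)))
    (q : ι × ι) : {r ∈ J | q.1 = r.1 ∨ q.1 = r.2 ∨ q.2 = r.1 ∨ q.2 = r.2}.card ≤ 4 := by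
  have hone {g : ι × ι → ι} (hg : Set.InjOn g (J : Set (ι × ι))) (i : ι) :
      {r ∈ J | i = g r}.card ≤ 1 := Finset.card_le_one.2 fun r hr s hs => by
    rw [Finset.mem_filter] at hr hs
    exact hg hr.1 hs.1 (hr.2.symm.trans hs.2)
  simp only [Finset.filter_or]
  refine (Finset.card_union_le _ _).trans (Nat.add_le_add (b := 1) (d := 3) (hone hfst _) ?_)
  refine (Finset.card_union_le _ _).trans (Nat.add_le_add (b := 1) (d := 2) (hone hsnd _) ?_)
  exact (Finset.card_union_le _ _).trans
    (Nat.add_le_add (b := 1) (d := 1) (hone hfst _) (hone hsnd _))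

lemma measure_sum_pair_le (hX : ∀ i, HasLaw (X i) L P) (hind : iIndepFun X P) {f : E × E → ℝ}
    (hf : Measurable f) (hf01 : ∀ z, f z ∈ Set.Icc (0 : ℝ) 1) (hpos : 0 < ∫ z, f z ∂L.prod L)
    {J : Finset (ι × ι)} (hJ : J.Nonempty) (hne : ∀ q ∈ J, q.1 ≠ q.2)
    (hfst : Set.InjOn Prod.fst (J : Set (ι × ι)))
    (hsnd : Set.InjOn Prod.snd (J : Set (ι × ι))) :
    P {ω | ∑ q ∈ J, f (X q.1 ω, X q.2 ω) ≤ (∫ z, f z ∂L.prod L) / 2 * J.card} ≤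
      ENNReal.ofReal (16 / (∫ z, f z ∂L.prod L) ^ 2 / J.card) := by
  classical
  have hm (q : ι × ι) : AEMeasurable (fun ω => f (X q.1 ω, X q.2 ω)) P :=
    hf.comp_aemeasurable ((hX q.1).aemeasurable.prodMk (hX q.2).aemeasurable)
  have hL2 (q : ι × ι) := memLp_of_mem_Icc_zero_one (hm q) (fun ω => hf01 _) 2
  have hvar : Var[fun ω => ∑ q ∈ J, f (X q.1 ω, X q.2 ω); P] ≤ (4 : ℕ) * J.card :=
    variance_sum_le_of_card_filter_le hm (fun _ _ => hf01 _)
      (fun q _ r _ h => covariance_pair_eq_zero hX hind hf hf01 h)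
      fun q _ => card_filter_sharing_le hfst hsnd q
  have hmean : P[fun ω => ∑ q ∈ J, f (X q.1 ω, X q.2 ω)] =
      (∫ z, f z ∂L.prod L) * J.card := by
    rw [integral_finsetSum _ fun q _ => (hL2 q).integrable (by norm_num), mul_comm,
      ← nsmul_eq_mul, ← Finset.sum_const]
    exact Finset.sum_congr rfl fun q hq => ((hind.indepFun (hne q hq)).hasLaw_prod
      (hX q.1) (hX q.2)).integral_comp hf.aestronglyMeasurable
  have hcard : (0 : ℝ) < J.card := by exact_mod_cast hJ.card_pos
  have hcheb := measure_le_half_le_of_le_integral (memLp_finsetSum _ fun q _ => hL2 q)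
    (mul_pos hpos hcard) hmean.ge hvar
  rw [mul_div_right_comm] at hcheb
  refine hcheb.trans_eq (congrArg _ ?_)
  push_cast
  field_simp
  norm_num

end WeakDependence

section MeanSquare

variable {Ω α β : Type*} [MeasurableSpace Ω] {P : Measure Ω} [MeasurableSpace α]
  [MeasurableSpace β]

lemma measure_lt_mean_sq_le [IsFiniteMeasure P] {n : ℕ} {y : Fin n → Ω → ℝ} {s B : ℝ}
    (hs : 0 ≤ s) (hB : 0 < B) (hy : ∀ i, MemLp (y i) 2 P)
    (hvar : ∀ i, P[fun ω => y i ω ^ 2] ≤ s) :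
    P {ω | B < (1 / (n : ℝ)) * ∑ i, y i ω ^ 2} ≤ ENNReal.ofReal (s / B) := by
  have hint : Integrable (fun ω => (1 / (n : ℝ)) * ∑ i, y i ω ^ 2) P :=
    (integrable_finsetSum _ fun i _ => (hy i).integrable_sq).const_mul _
  have hmean : P[fun ω => (1 / (n : ℝ)) * ∑ i, y i ω ^ 2] ≤ s := by
    rw [integral_const_mul, integral_finsetSum _ fun i _ => (hy i).integrable_sq, one_div]
    refine inv_mul_le_of_le_mul₀ n.cast_nonneg hs ?_
    simpa using Finset.sum_le_sum fun i (_ : i ∈ Finset.univ) => hvar i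
  have hmarkov := mul_meas_ge_le_integral_of_nonneg
    (ae_of_all _ fun ω => by positivity) hint B
  calc P {ω | B < (1 / (n : ℝ)) * ∑ i, y i ω ^ 2}
      ≤ P {ω | B ≤ (1 / (n : ℝ)) * ∑ i, y i ω ^ 2} :=
        measure_mono fun ω (hω : B < _) => hω.le
    _ = ENNReal.ofReal (P.real {ω | B ≤ (1 / (n : ℝ)) * ∑ i, y i ω ^ 2}) :=
        (ofReal_measureReal (measure_ne_top P _)).symm
    _ ≤ ENNReal.ofReal (s / B) :=
        ENNReal.ofReal_le_ofReal ((le_div_iff₀' hB).2 (hmarkov.trans hmean))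

lemma measure_prod_le_of_sections {μ : Measure α} [IsProbabilityMeasure μ] {ν : Measure β}
    [IsProbabilityMeasure ν] {s : Set (α × β)} (hs : NullMeasurableSet s (μ.prod ν)) (t : Set α)
    {c : ENNReal} (h : ∀ᵐ x ∂μ, x ∉ t → ν (Prod.mk x ⁻¹' s) ≤ c) : μ.prod ν s ≤ μ t + c := by
  have hm : AEMeasurable (s.indicator (1 : α × β → ENNReal)) (μ.prod ν) :=
    (aemeasurable_const (b := (1 : ENNReal))).indicator₀ hs
  calc μ.prod ν s = ∫⁻ x, ∫⁻ y, (Prod.mk x ⁻¹' s).indicator 1 y ∂ν ∂μ := by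
        rw [← lintegral_indicator_one₀ hs, lintegral_prod _ hm]
        rfl
    _ ≤ ∫⁻ x, (t.indicator 1 x + c) ∂μ := by
        refine lintegral_mono_ae ?_
        filter_upwards [h] with x hx
        refine (lintegral_indicator_one_le _).trans ?_
        by_cases hxt : x ∈ t
        · exact prob_le_one.trans (by simp [hxt])
        · exact (hx hxt).trans le_add_self
    _ = ∫⁻ x, t.indicator 1 x ∂μ + c := by
        rw [lintegral_add_right _ measurable_const]; simp
    _ ≤ μ t + c := by gcongr; exact lintegral_indicator_one_le t

end MeanSquare

section SchurTest

variable {ι : Type*} [Fintype ι] [DecidableEq ι]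

lemma le_smul_one_of_sum_abs_le {M : Matrix ι ι ℝ} (hM : M.IsHermitian) {S : ℝ}
    (hS : ∀ i, ∑ j, |M i j| ≤ S) : M ≤ S • 1 := by
  rw [le_iff_forall_dotProduct_mulVec_le hM (isHermitian_one.smul (IsSelfAdjoint.all S))]
  intro x
  -- Schur's test: `2 |x i| |x j| ≤ x i ^ 2 + x j ^ 2` leaves only the row sums.
  have hpair (i j : ι) : M i j * (x i * x j) ≤ |M i j| * x i ^ 2 / 2 + |M j i| * x j ^ 2 / 2 := by
    rw [show M j i = M i j from hM.apply i j]
    have h : |x i * x j| ≤ x i ^ 2 / 2 + x j ^ 2 / 2 := by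
      rw [abs_mul, ← sq_abs (x i), ← sq_abs (x j)]
      linarith [two_mul_le_add_sq |x i| |x j|]
    calc M i j * (x i * x j) ≤ |M i j| * |x i * x j| := by
          rw [← abs_mul]; exact le_abs_self _
      _ ≤ |M i j| * (x i ^ 2 / 2 + x j ^ 2 / 2) := by gcongr
      _ = |M i j| * x i ^ 2 / 2 + |M i j| * x j ^ 2 / 2 := by ring
  calc x ⬝ᵥ M *ᵥ x = ∑ i, ∑ j, M i j * (x i * x j) := by
        simp only [dotProduct, mulVec, Finset.mul_sum, mul_left_comm]
    _ ≤ ∑ i, ∑ j, (|M i j| * x i ^ 2 / 2 + |M j i| * x j ^ 2 / 2) := by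
        gcongr with i _ j _; exact hpair i j
    _ = ∑ i, (∑ j, |M i j|) * x i ^ 2 := by
        simp only [Finset.sum_add_distrib]
        rw [Finset.sum_comm (f := fun i j => |M j i| * x j ^ 2 / 2), ← Finset.sum_add_distrib]
        exact Finset.sum_congr rfl fun i _ => by rw [← Finset.sum_div, ← Finset.sum_mul, add_halves]
    _ ≤ ∑ i, S * x i ^ 2 := by gcongr with i _; exact hS i
    _ = x ⬝ᵥ (S • (1 : Matrix ι ι ℝ)) *ᵥ x := by
        simp [smul_mulVec, dotProduct, sq, mul_left_comm S]

end SchurTest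

section LatticeSum

variable {d : ℕ}

lemma summable_inv_norm_pow_int (d : ℕ) :
    Summable fun u : Fin d → ℤ => (‖u‖⁻¹) ^ (d + 1) := by
  set L := Submodule.span ℤ (Set.range (Pi.basisFun ℝ (Fin d)))
  have hsum : Summable fun u : L => (‖u‖⁻¹) ^ (d + 1) :=
    ZLattice.summable_norm_pow_inv L (d + 1) (by simp [ZLattice.rank ℝ L])
  have hmem (u : Fin d → ℤ) : (fun k => (u k : ℝ)) ∈ L :=
    (Module.Basis.mem_span_iff_repr_mem ℤ _ _).2 fun k => ⟨u k, by simp⟩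
  have hinj : Function.Injective fun u : Fin d → ℤ => (⟨fun k => (u k : ℝ), hmem u⟩ : L) :=
    fun u u' h => funext fun k => by simpa using congrFun (congrArg Subtype.val h) k
  refine (hsum.comp_injective hinj).congr fun u => ?_
  have hnorm : ‖(⟨fun k => (u k : ℝ), hmem u⟩ : L)‖ = ‖u‖ := by
    simp only [Pi.norm_def]
    rfl
  rw [Function.comp_apply, hnorm]

/-- The lattice sum `∑_{u ≠ 0} |u|_∞^{-(d+1)}` over `ℤ^d`; the term at `u = 0` vanishes since
`0⁻¹ = 0`. -/
noncomputable def latticeSum (d : ℕ) : ℝ := ∑' u : Fin d → ℤ, (‖u‖⁻¹) ^ (d + 1)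

lemma latticeSum_nonneg (d : ℕ) : 0 ≤ latticeSum d := tsum_nonneg fun _ => by positivity

lemma sum_inv_norm_sub_pow_le {ι : Type*} [Fintype ι] {w : ι → Fin d → ℤ}
    (hw : Function.Injective w) (i : ι) : ∑ j, (‖w i - w j‖⁻¹) ^ (d + 1) ≤ latticeSum d := by
  have hinj : Function.Injective fun j => w i - w j := sub_right_injective.comp hw
  have := (summable_inv_norm_pow_int d).sum_le_tsum (Finset.univ.map ⟨_, hinj⟩)
    fun _ _ => by positivity
  rwa [Finset.sum_map] at this

end LatticeSum

section KernelMatrix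

/-- The matrix of the stationary kernel `(s, t) ↦ k (s - t)` at the points `z i`. -/
def kernelMatrix {ι E : Type*} [Sub E] (k : E → ℝ) (z : ι → E) : Matrix ι ι ℝ :=
  Matrix.of fun i j => k (z i - z j)

variable {ι E : Type*} [NormedAddCommGroup E] {k : E → ℝ} {z : ι → E}

lemma isHermitian_kernelMatrix (hk : ∀ t, k (-t) = k t) (z : ι → E) :
    (kernelMatrix k z).IsHermitian :=
  IsHermitian.ext fun i j => by simp [kernelMatrix, ← hk (z i - z j)]

lemma kernelMatrix_neg (k : E → ℝ) (z : ι → E) : kernelMatrix (-k) z = -kernelMatrix k z := rfl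

/-- Quantitative separation of points `z i` indexed by distinct integer points `w i`: distances
between the `z i` are at least `δ` times the (sup norm) distances between the `w i`. -/
structure IsSeparated {d : ℕ} (δ : ℝ) (w : ι → Fin d → ℤ) (z : ι → E) : Prop where
  injective : Function.Injective w
  le_norm_sub : ∀ i j, δ * ‖w i - w j‖ ≤ ‖z i - z j‖

variable {d : ℕ} {δ : ℝ} {w : ι → Fin d → ℤ}

lemma IsSeparated.smul [NormedSpace ℝ E] (h : IsSeparated δ w z) {r : ℝ} (hr : 0 ≤ r) :
    IsSeparated (r * δ) w (r • z) where
  injective := h.injective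
  le_norm_sub i j := by
    rw [Pi.smul_apply, Pi.smul_apply, ← smul_sub, norm_smul, Real.norm_of_nonneg hr, mul_assoc]
    exact mul_le_mul_of_nonneg_left (h.le_norm_sub i j) hr

lemma IsSeparated.abs_kernel_le (h : IsSeparated δ w z) (hδ : 0 < δ) {a : ℝ} (ha : 0 ≤ a)
    (hk : ∀ t ≠ 0, |k t| ≤ a / ‖t‖ ^ (d + 1)) {i j : ι} (hij : i ≠ j) :
    |k (z i - z j)| ≤ a / δ ^ (d + 1) * (‖w i - w j‖⁻¹) ^ (d + 1) := by
  have hpos : 0 < δ * ‖w i - w j‖ :=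
    mul_pos hδ (norm_pos_iff.2 (sub_ne_zero.2 (h.injective.ne hij)))
  have hz := h.le_norm_sub i j
  calc |k (z i - z j)| ≤ a / ‖z i - z j‖ ^ (d + 1) := hk _ (norm_pos_iff.1 (hpos.trans_le hz))
    _ ≤ a / (δ * ‖w i - w j‖) ^ (d + 1) := by gcongr
    _ = a / δ ^ (d + 1) * (‖w i - w j‖⁻¹) ^ (d + 1) := by
      rw [mul_pow, inv_pow, div_mul_eq_div_div, div_eq_mul_inv (a / _)]

variable [DecidableEq ι]

lemma IsSeparated.sum_abs_kernelMatrix_sub_le [Fintype ι] (h : IsSeparated δ w z) (hδ : 0 < δ)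
    {a : ℝ} (ha : 0 ≤ a) (hk : ∀ t ≠ 0, |k t| ≤ a / ‖t‖ ^ (d + 1)) (i : ι) :
    ∑ j, |(kernelMatrix k z - k 0 • 1) i j| ≤ a * latticeSum d / δ ^ (d + 1) := by
  calc ∑ j, |(kernelMatrix k z - k 0 • 1) i j|
      ≤ ∑ j, a / δ ^ (d + 1) * (‖w i - w j‖⁻¹) ^ (d + 1) := by
        refine Finset.sum_le_sum fun j _ => ?_
        rcases eq_or_ne i j with rfl | hij
        · simp [kernelMatrix]
        · simpa [kernelMatrix, one_apply_ne hij] using h.abs_kernel_le hδ ha hk hij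
    _ ≤ a * latticeSum d / δ ^ (d + 1) := by
        rw [← Finset.mul_sum, mul_div_right_comm]
        exact mul_le_mul_of_nonneg_left (sum_inv_norm_sub_pow_le h.injective i) (by positivity)

variable [Finite ι]

lemma IsSeparated.kernelMatrix_le (h : IsSeparated δ w z) (hδ : 0 < δ)
    (heven : ∀ t, k (-t) = k t) {a : ℝ} (ha : 0 ≤ a)
    (hk : ∀ t ≠ 0, |k t| ≤ a / ‖t‖ ^ (d + 1)) :
    kernelMatrix k z ≤ (k 0 + a * latticeSum d / δ ^ (d + 1)) • 1 := by
  cases nonempty_fintype ι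
  rw [add_smul, ← sub_le_iff_le_add']
  exact le_smul_one_of_sum_abs_le ((isHermitian_kernelMatrix heven z).sub
    (isHermitian_one.smul (IsSelfAdjoint.all _))) (h.sum_abs_kernelMatrix_sub_le hδ ha hk)

lemma IsSeparated.le_kernelMatrix (h : IsSeparated δ w z) (hδ : 0 < δ)
    (heven : ∀ t, k (-t) = k t) {a : ℝ} (ha : 0 ≤ a)
    (hk : ∀ t ≠ 0, |k t| ≤ a / ‖t‖ ^ (d + 1)) :
    (k 0 - a * latticeSum d / δ ^ (d + 1)) • 1 ≤ kernelMatrix k z := by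
  have := h.kernelMatrix_le (k := -k) hδ (by simpa using heven) ha (by simpa using hk)
  rw [kernelMatrix_neg, neg_le, ← neg_smul] at this
  convert this using 2
  simp only [Pi.neg_apply]
  ring

lemma IsSeparated.kernelMatrix_le_of_abs_le (h : IsSeparated δ w z) (hδ : 0 < δ)
    (heven : ∀ t, k (-t) = k t) {a : ℝ} (hk : ∀ t, |k t| ≤ a / (1 + ‖t‖ ^ (d + 1))) :
    kernelMatrix k z ≤ (a * (1 + latticeSum d / δ ^ (d + 1))) • 1 := by
  cases nonempty_fintype ι
  have h0 : |k 0| ≤ a := by simpa using hk 0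
  have ha : 0 ≤ a := (abs_nonneg _).trans h0
  refine (h.kernelMatrix_le hδ heven ha fun t ht => (hk t).trans ?_).trans ?_
  · have := norm_pos_iff.2 ht
    gcongr
    exact le_add_of_nonneg_left zero_le_one
  · rw [mul_add, mul_one, mul_div_assoc]
    gcongr
    exact (le_abs_self _).trans h0

end KernelMatrix

section CosineTransform

variable {E : Type*} [NormedAddCommGroup E] [InnerProductSpace ℝ E] [FiniteDimensional ℝ E]
  [MeasurableSpace E] [BorelSpace E] {g h : E → ℝ}

/-- The cosine transform `t ↦ ∫ g(f) cos(f·t) df`, which for an even `g` is the Fourier integral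
`∫ g(f) e^{i f·t} df`. -/
noncomputable def cosTransform (g : E → ℝ) (t : E) : ℝ := ∫ f, g f * Real.cos (inner ℝ f t)

lemma cosTransform_zero (g : E → ℝ) : cosTransform g 0 = ∫ f, g f := by simp [cosTransform]

lemma cosTransform_neg (g : E → ℝ) (t : E) : cosTransform g (-t) = cosTransform g t := by
  simp [cosTransform]

lemma cosTransform_const_mul (c : ℝ) (g : E → ℝ) (t : E) :
    cosTransform (fun f => c * g f) t = c * cosTransform g t := by
  simp only [cosTransform, mul_assoc, integral_const_mul]

lemma cosTransform_comp_inv_smul (g : E → ℝ) {r : ℝ} (hr : 0 < r) (t : E) :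
    cosTransform (fun f => g (r⁻¹ • f)) t = r ^ Module.finrank ℝ E * cosTransform g (r • t) := by
  have := Measure.integral_comp_inv_smul_of_nonneg volume
    (fun f : E => g f * Real.cos (inner ℝ f (r • t))) hr.le
  rw [smul_eq_mul] at this
  rw [cosTransform, cosTransform, ← this]
  simp only [inner_smul_left, inner_smul_right, RCLike.conj_to_real, mul_inv_cancel_left₀ hr.ne']

lemma integrable_mul_cos (hg : Integrable g) (t : E) :
    Integrable fun f => g f * Real.cos (inner ℝ f t) :=
  hg.mul_bdd (c := 1) (Continuous.aestronglyMeasurable (by fun_prop))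
    (ae_of_all _ fun _ => Real.abs_cos_le_one _)

lemma continuous_cosTransform (hg : Integrable g) : Continuous (cosTransform g) := by
  refine continuous_of_dominated (bound := fun f => |g f|)
    (fun t => (integrable_mul_cos hg t).aestronglyMeasurable)
    (fun t => ae_of_all _ fun f => ?_) hg.abs (ae_of_all _ fun f => by fun_prop)
  rw [norm_mul, Real.norm_eq_abs, Real.norm_eq_abs]
  exact mul_le_of_le_one_right (abs_nonneg _) (Real.abs_cos_le_one _)

lemma cosTransform_sub (hg : Integrable g) (hh : Integrable h) :
    cosTransform (h - g) = cosTransform h - cosTransform g := by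
  ext t
  simp only [cosTransform, Pi.sub_apply, sub_mul]
  exact integral_sub (integrable_mul_cos hh t) (integrable_mul_cos hg t)

lemma cosTransform_eq_re_fourier (hg : Integrable g) (t : E) :
    cosTransform g t = (𝓕 (fun f => (g f : ℂ)) ((2 * Real.pi)⁻¹ • t)).re := by
  have hint : Integrable fun f : E =>
      Complex.exp (↑(-2 * Real.pi * inner ℝ f ((2 * Real.pi)⁻¹ • t)) * Complex.I) • (g f : ℂ) :=
    (hg.ofReal (𝕜 := ℂ)).bdd_mul (c := 1) (Continuous.aestronglyMeasurable (by fun_prop))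
      (ae_of_all _ fun f => (Complex.norm_exp_ofReal_mul_I _).le)
  rw [Real.fourier_eq', ← RCLike.re_to_complex, ← integral_re hint, cosTransform]
  refine integral_congr_ae (ae_of_all _ fun f => ?_)
  have hphase : -2 * Real.pi * inner ℝ f ((2 * Real.pi)⁻¹ • t) = -inner ℝ f t := by
    rw [inner_smul_right]
    field_simp [Real.pi_ne_zero]
  simp only [hphase, smul_eq_mul, RCLike.re_to_complex, Complex.re_mul_ofReal,
    Complex.exp_ofReal_mul_I_re, Real.cos_neg]
  exact mul_comm _ _

lemma exists_abs_cosTransform_le (hg : ContDiff ℝ ((⊤ : ℕ∞) : WithTop ℕ∞) g)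
    (hsupp : HasCompactSupport g) (N : ℕ) :
    ∃ C ≥ 0, ∀ t ≠ 0, |cosTransform g t| ≤ C / ‖t‖ ^ N := by
  have hcs : HasCompactSupport fun f => (g f : ℂ) :=
    hsupp.comp_left (g := fun r : ℝ => (r : ℂ)) (by simp)
  have hcd : ContDiff ℝ ((⊤ : ℕ∞) : WithTop ℕ∞) fun f => (g f : ℂ) :=
    Complex.ofRealCLM.contDiff.comp hg
  obtain ⟨C, hC, hdecay⟩ := (𝓕 (hcs.toSchwartzMap hcd)).decay N 0
  refine ⟨C * (2 * Real.pi) ^ N, by positivity, fun t ht => ?_⟩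
  have h := hdecay ((2 * Real.pi)⁻¹ • t)
  rw [norm_iteratedFDeriv_zero, norm_smul, norm_inv, Real.norm_of_nonneg Real.two_pi_pos.le,
    mul_pow, inv_pow, mul_assoc, inv_mul_le_iff₀ (by positivity), SchwartzMap.fourier_coe] at h
  rw [cosTransform_eq_re_fourier (hg.continuous.integrable_of_hasCompactSupport hsupp),
    le_div_iff₀' (pow_pos (norm_pos_iff.2 ht) _), mul_comm C]
  exact (mul_le_mul_of_nonneg_left (Complex.abs_re_le_norm _) (by positivity)).trans h

section LoewnerBound

variable {ι : Type*}

lemma kernelMatrix_cosTransform_comp_inv_smul (g : E → ℝ) {r : ℝ} (hr : 0 < r) (z : ι → E) :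
    kernelMatrix (cosTransform fun f => g (r⁻¹ • f)) z =
      r ^ Module.finrank ℝ E • kernelMatrix (cosTransform g) (r • z) := by
  ext i j
  simp [kernelMatrix, cosTransform_comp_inv_smul g hr, smul_sub]

lemma sum_sum_cos_sub_mul [Fintype ι] (s x : ι → ℝ) :
    ∑ i, ∑ j, Real.cos (s i - s j) * (x i * x j) =
      (∑ i, x i * Real.cos (s i)) ^ 2 + (∑ i, x i * Real.sin (s i)) ^ 2 := by
  simp only [sq, Finset.sum_mul_sum, ← Finset.sum_add_distrib]
  refine Finset.sum_congr rfl fun i _ => Finset.sum_congr rfl fun j _ => ?_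
  rw [Real.cos_sub]
  ring

lemma dotProduct_kernelMatrix_cosTransform_mulVec [Fintype ι] (hg : Integrable g) (z : ι → E)
    (x : ι → ℝ) :
    x ⬝ᵥ kernelMatrix (cosTransform g) z *ᵥ x =
      ∫ f, g f * ∑ i, ∑ j, Real.cos (inner ℝ f (z i) - inner ℝ f (z j)) * (x i * x j) := by
  have hint (i j : ι) : Integrable fun f =>
      g f * Real.cos (inner ℝ f (z i - z j)) * (x i * x j) := (integrable_mul_cos hg _).mul_const _
  simp only [Finset.mul_sum, ← inner_sub_right, ← mul_assoc (g _)]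
  rw [integral_finsetSum _ fun i _ => integrable_finsetSum _ fun j _ => hint i j]
  simp only [dotProduct, mulVec, Finset.mul_sum]
  refine Finset.sum_congr rfl fun i _ => ?_
  rw [integral_finsetSum _ fun j _ => hint i j]
  refine Finset.sum_congr rfl fun j _ => ?_
  rw [integral_mul_const, kernelMatrix, of_apply, cosTransform]
  ring

variable [Finite ι]

lemma kernelMatrix_cosTransform_nonneg (hg : Integrable g) (hg0 : ∀ f, 0 ≤ g f) (z : ι → E) :
    0 ≤ kernelMatrix (cosTransform g) z := by
  cases nonempty_fintype ι
  rw [le_iff_forall_dotProduct_mulVec_le isHermitian_zero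
    (isHermitian_kernelMatrix (cosTransform_neg g) z)]
  intro x
  rw [dotProduct_kernelMatrix_cosTransform_mulVec hg, zero_mulVec, dotProduct_zero]
  refine integral_nonneg fun f => mul_nonneg (hg0 f) ?_
  rw [sum_sum_cos_sub_mul fun i => inner ℝ f (z i)]
  positivity

lemma kernelMatrix_cosTransform_mono (hg : Integrable g) (hh : Integrable h)
    (hgh : ∀ f, g f ≤ h f) (z : ι → E) :
    kernelMatrix (cosTransform g) z ≤ kernelMatrix (cosTransform h) z := by
  rw [← sub_nonneg]
  convert kernelMatrix_cosTransform_nonneg (hh.sub hg) (fun f => sub_nonneg.2 (hgh f)) z using 1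
  rw [cosTransform_sub hg hh]
  rfl

lemma exists_bump_smul_one_le_kernelMatrix (E : Type*) [NormedAddCommGroup E]
    [InnerProductSpace ℝ E] [FiniteDimensional ℝ E] [MeasurableSpace E] [BorelSpace E] (d : ℕ)
    {δ : ℝ} (hδ : 0 < δ) :
    ∃ g : E → ℝ, Continuous g ∧ HasCompactSupport g ∧ (∀ f, g f ∈ Set.Icc 0 1) ∧ ∃ c > (0 : ℝ),
      ∀ (n : ℕ) (w : Fin n → Fin d → ℤ) (z : Fin n → E), IsSeparated δ w z →
        c • 1 ≤ kernelMatrix (cosTransform g) z := by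
  -- Stretching a bump by `r` amounts to spreading the points by `r`, which makes the off-diagonal
  -- entries negligible against the diagonal.
  let b : ContDiffBump (0 : E) := ⟨1 / 2, 1, by norm_num, by norm_num⟩
  have hb : 0 < cosTransform b 0 := by
    rw [cosTransform_zero]
    exact b.integral_pos
  obtain ⟨C, hC, hdecay⟩ := exists_abs_cosTransform_le b.contDiff b.hasCompactSupport (d + 1)
  obtain ⟨r, hr, hrb⟩ : ∃ r > 0,
      C * latticeSum d / (r * δ) ^ (d + 1) < cosTransform b 0 := by
    have hlim : Tendsto (fun r : ℝ => C * latticeSum d / (r * δ) ^ (d + 1)) atTop (𝓝 0) :=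
      ((tendsto_pow_atTop d.succ_ne_zero).comp
        (tendsto_id.atTop_mul_const hδ)).const_div_atTop _
    exact ((eventually_gt_atTop 0).and (hlim.eventually (gt_mem_nhds hb))).exists
  have hr1 : r⁻¹ ≠ 0 := (inv_pos.2 hr).ne'
  let c : ℝ := r ^ Module.finrank ℝ E *
    (cosTransform b 0 - C * latticeSum d / (r * δ) ^ (d + 1))
  refine ⟨fun f => b (r⁻¹ • f), b.continuous.comp (continuous_const_smul _),
    b.hasCompactSupport.comp_smul hr1, fun f => ⟨b.nonneg, b.le_one⟩,
    c, mul_pos (by positivity) (sub_pos.2 hrb), fun n w z hz => ?_⟩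
  rw [kernelMatrix_cosTransform_comp_inv_smul b hr, mul_smul]
  exact smul_le_smul_of_nonneg_left ((hz.smul hr.le).le_kernelMatrix (by positivity)
    (cosTransform_neg _) hC hdecay) (by positivity)

end LoewnerBound

end CosineTransform

section SpectralModel

variable {d : ℕ} {Ξ : Type*} [TopologicalSpace Ξ] {Θ : Set Ξ}
  {K φ : Ξ → EuclideanSpace ℝ (Fin d) → ℝ} {θ : Ξ}

/-- The part of the regularity of `{K_θ, θ ∈ Θ}` on which consistency rests: `K_θ` is the cosine
transform of a positive spectral density `φ_θ`, jointly continuous in the frequency and in `θ`,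
and `K_θ` is bounded and varies continuously with `θ` in the norm with weight `1 + |t|^{d+1}`. -/
structure SpectralModel (Θ : Set Ξ) (K φ : Ξ → EuclideanSpace ℝ (Fin d) → ℝ) : Prop where
  exists_abs_le : ∃ C, ∀ θ ∈ Θ, ∀ t, |K θ t| ≤ C / (1 + ‖t‖ ^ (d + 1))
  eventually_abs_sub_le : ∀ θ ∈ Θ, ∀ η > 0, ∀ᶠ θ' in 𝓝[Θ] θ, ∀ t,
    |K θ' t - K θ t| ≤ η / (1 + ‖t‖ ^ (d + 1))
  integrable : ∀ θ ∈ Θ, Integrable (φ θ)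
  eq_cosTransform : ∀ θ ∈ Θ, K θ = cosTransform (φ θ)
  continuousOn : ContinuousOn (fun q : EuclideanSpace ℝ (Fin d) × Ξ => φ q.2 q.1) (Set.univ ×ˢ Θ)
  pos : ∀ θ ∈ Θ, ∀ f, 0 < φ θ f

lemma SpectralModel.continuous_kernel (h : SpectralModel Θ K φ) (hθ : θ ∈ Θ) :
    Continuous (K θ) := by
  rw [h.eq_cosTransform θ hθ]
  exact continuous_cosTransform (h.integrable θ hθ)

lemma SpectralModel.kernel_neg (h : SpectralModel Θ K φ) (hθ : θ ∈ Θ)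
    (t : EuclideanSpace ℝ (Fin d)) : K θ (-t) = K θ t := by
  rw [h.eq_cosTransform θ hθ, cosTransform_neg]

lemma SpectralModel.exists_mul_le_density (h : SpectralModel Θ K φ) (hΘ : IsCompact Θ)
    {g : EuclideanSpace ℝ (Fin d) → ℝ} (hg : HasCompactSupport g)
    (hg01 : ∀ f, g f ∈ Set.Icc 0 1) : ∃ m > 0, ∀ θ ∈ Θ, ∀ f, m * g f ≤ φ θ f := by
  obtain ⟨m, hm, hmφ⟩ := (hg.isCompact.prod hΘ).exists_forall_le'
    (h.continuousOn.mono (Set.prod_mono (Set.subset_univ _) subset_rfl)) (a := 0)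
    fun q hq => h.pos q.2 hq.2 q.1
  refine ⟨m, hm, fun θ hθ f => ?_⟩
  by_cases hf : f ∈ tsupport g
  · exact (mul_le_of_le_one_right hm.le (hg01 f).2).trans (hmφ (f, θ) ⟨hf, hθ⟩)
  · rw [image_eq_zero_of_notMem_tsupport hf, mul_zero]
    exact (h.pos θ hθ f).le

lemma SpectralModel.exists_smul_one_le (h : SpectralModel Θ K φ) (hΘ : IsCompact Θ) {δ : ℝ}
    (hδ : 0 < δ) :
    ∃ c > (0 : ℝ), ∀ θ ∈ Θ, ∀ (n : ℕ) (w : Fin n → Fin d → ℤ)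
      (z : Fin n → EuclideanSpace ℝ (Fin d)), IsSeparated δ w z →
        c • 1 ≤ kernelMatrix (K θ) z := by
  obtain ⟨g, hg, hsupp, hg01, c, hc, hcg⟩ :=
    exists_bump_smul_one_le_kernelMatrix (EuclideanSpace ℝ (Fin d)) d hδ
  obtain ⟨m, hm, hmφ⟩ := h.exists_mul_le_density hΘ hsupp hg01
  refine ⟨m * c, mul_pos hm hc, fun θ hθ n w z hz => ?_⟩
  calc (m * c) • (1 : Matrix (Fin n) (Fin n) ℝ)
      ≤ m • kernelMatrix (cosTransform g) z := by
        rw [mul_smul]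
        exact smul_le_smul_of_nonneg_left (hcg n w z hz) hm.le
    _ = kernelMatrix (cosTransform fun f => m * g f) z := by
        ext i j
        simp [kernelMatrix, cosTransform_const_mul]
    _ ≤ kernelMatrix (cosTransform (φ θ)) z :=
        kernelMatrix_cosTransform_mono ((hg.integrable_of_hasCompactSupport hsupp).const_mul m)
          (h.integrable θ hθ) (hmφ θ hθ) z
    _ = kernelMatrix (K θ) z := by rw [h.eq_cosTransform θ hθ]

lemma SpectralModel.exists_le_smul_one (h : SpectralModel Θ K φ) {δ : ℝ} (hδ : 0 < δ) :
    ∃ C > (0 : ℝ), ∀ θ ∈ Θ, ∀ (n : ℕ) (w : Fin n → Fin d → ℤ)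
      (z : Fin n → EuclideanSpace ℝ (Fin d)), IsSeparated δ w z →
        kernelMatrix (K θ) z ≤ C • 1 := by
  obtain ⟨a, ha⟩ := h.exists_abs_le
  refine ⟨max 1 (a * (1 + latticeSum d / δ ^ (d + 1))), by positivity,
    fun θ hθ n w z hz => ?_⟩
  exact (hz.kernelMatrix_le_of_abs_le hδ (h.kernel_neg hθ) (ha θ hθ)).trans
    (smul_le_smul_of_nonneg_right (le_max_right _ _) zero_le_one)

lemma SpectralModel.eventually_kernelMatrix_le_add (h : SpectralModel Θ K φ) (hθ : θ ∈ Θ)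
    {δ κ : ℝ} (hδ : 0 < δ) (hκ : 0 < κ) :
    ∀ᶠ θ' in 𝓝[Θ] θ, ∀ (n : ℕ) (w : Fin n → Fin d → ℤ) (z : Fin n → EuclideanSpace ℝ (Fin d)),
      IsSeparated δ w z → kernelMatrix (K θ) z ≤ kernelMatrix (K θ') z + κ • 1 ∧
        kernelMatrix (K θ') z ≤ kernelMatrix (K θ) z + κ • 1 := by
  have hD : 0 < 1 + latticeSum d / δ ^ (d + 1) := by
    have := latticeSum_nonneg d
    positivity
  filter_upwards [h.eventually_abs_sub_le θ hθ _ (div_pos hκ hD), self_mem_nhdsWithin]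
    with θ' hθθ' hθ' n w z hz
  have key : ∀ {θ₁ θ₂}, θ₁ ∈ Θ → θ₂ ∈ Θ → (∀ t, |(K θ₂ - K θ₁) t| ≤
      κ / (1 + latticeSum d / δ ^ (d + 1)) / (1 + ‖t‖ ^ (d + 1))) →
      kernelMatrix (K θ₂) z ≤ kernelMatrix (K θ₁) z + κ • 1 := by
    intro θ₁ θ₂ h₁ h₂ hle
    have := hz.kernelMatrix_le_of_abs_le hδ
      (fun t => by simp only [Pi.sub_apply, h.kernel_neg h₁, h.kernel_neg h₂]) hle
    rw [div_mul_cancel₀ _ hD.ne'] at this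
    exact sub_le_iff_le_add'.1 this
  exact ⟨key hθ' hθ fun t => by rw [Pi.sub_apply, abs_sub_comm]; exact hθθ' t, key hθ hθ' hθθ'⟩

end SpectralModel

section Grid

variable {d : ℕ} {v : ℕ → Fin d → ℤ}

lemma IsGridSequence.image_Iio (hv : IsGridSequence v) {N : ℕ} (hN : 1 ≤ N) :
    v '' Set.Iio (N ^ d) = Set.Icc 1 fun _ => (N : ℤ) := by
  rw [hv N hN]
  ext u
  simp [Pi.le_def, forall_and]

lemma IsGridSequence.injective (hv : IsGridSequence v) (hd : 1 ≤ d) : Function.Injective v := by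
  have hinj {N : ℕ} (hN : 1 ≤ N) : Set.InjOn v (Set.Iio (N ^ d)) := by
    refine Set.injOn_of_ncard_image_eq ?_ (Set.finite_Iio _)
    rw [hv.image_Iio hN, ← Finset.coe_Icc, ← Finset.coe_Iio, Set.ncard_coe_finset,
      Set.ncard_coe_finset, Pi.card_Icc]
    simp
  intro i j hij
  have hlt : max i j < (max i j + 1) ^ d :=
    Nat.lt_of_succ_le (Nat.le_self_pow (Nat.one_le_iff_ne_zero.1 hd) _)
  exact hinj (Nat.le_add_left 1 _) ((le_max_left i j).trans_lt hlt)
    ((le_max_right i j).trans_lt hlt) hij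

lemma IsGridSequence.exists_fin_eq (hv : IsGridSequence v) {n N : ℕ} (hN : 1 ≤ N)
    (hn : N ^ d ≤ n) {w : Fin d → ℤ} (hw : w ∈ Set.Icc 1 fun _ => (N : ℤ)) :
    ∃ i : Fin n, v i = w := by
  rw [← hv.image_Iio hN] at hw
  obtain ⟨i, hi, rfl⟩ := hw
  exact ⟨⟨i, (Set.mem_Iio.1 hi).trans_le hn⟩, rfl⟩

lemma IsGridSequence.le_card_sub_eq (hv : IsGridSequence v) (hd : 1 ≤ d) (u : Fin d → ℤ) :
    ∀ᶠ n : ℕ in atTop,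
      n ≤ 4 ^ d * (Finset.univ.filter fun q : Fin n × Fin n => v q.1 - v q.2 = u).card := by
  obtain ⟨M, hM⟩ : ∃ M : ℕ, ∀ k, |u k| ≤ M :=
    ⟨∑ k, (u k).natAbs, fun k => by
      rw [Int.abs_eq_natAbs]
      exact_mod_cast Finset.single_le_sum (f := fun k => (u k).natAbs) (by simp)
        (Finset.mem_univ k)⟩
  filter_upwards [eventually_ge_atTop ((4 * M + 1) ^ d)] with n hn
  have hd0 := Nat.one_le_iff_ne_zero.1 hd
  set N := d.nthRoot n
  have hNn : N ^ d ≤ n := Nat.pow_nthRoot_le_iff.2 (.inl hd0)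
  have hnN : n < (N + 1) ^ d := Nat.lt_pow_nthRoot_add_one hd0 n
  have hMN : 4 * M + 1 ≤ N :=
    Nat.lt_add_one_iff.1 (lt_of_pow_lt_pow_left₀ d (Nat.zero_le _) (hn.trans_lt hnN))
  let box : Finset (Fin d → ℤ) := Finset.Icc (fun _ => (M : ℤ) + 1) (fun _ => (N : ℤ) - M)
  have hbox : box.card = (N - 2 * M) ^ d := by
    rw [Pi.card_Icc, Finset.prod_const, Finset.card_univ, Fintype.card_fin, Int.card_Icc]
    congr 1
    omega
  have hsurj : Set.SurjOn (fun q : Fin n × Fin n => v q.1)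
      (Finset.univ.filter fun q : Fin n × Fin n => v q.1 - v q.2 = u) box := by
    intro w hw
    simp only [box, Finset.coe_Icc, Set.mem_Icc, Pi.le_def] at hw
    obtain ⟨i, hi⟩ := hv.exists_fin_eq (w := w) (by omega) hNn
      ⟨fun k => by have := hw.1 k; simp only [Pi.one_apply]; omega,
        fun k => (hw.2 k).trans (Int.sub_le_self _ (Int.natCast_nonneg M))⟩
    obtain ⟨j, hj⟩ := hv.exists_fin_eq (w := w - u) (by omega) hNn
      ⟨fun k => by
        have := hw.1 k; have := abs_le.1 (hM k)
        simp only [Pi.one_apply, Pi.sub_apply]; omega,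
      fun k => by
        have := hw.2 k; have := abs_le.1 (hM k)
        simp only [Pi.sub_apply]; omega⟩
    exact ⟨(i, j), by simp [hi, hj], hi⟩
  calc n ≤ (4 * (N - 2 * M)) ^ d := hnN.le.trans (Nat.pow_le_pow_left (by omega) d)
    _ = 4 ^ d * box.card := by rw [mul_pow, hbox]
    _ ≤ _ := Nat.mul_le_mul_left _ (Finset.card_le_card_of_surjOn _ hsurj)

end Grid

section ObservationPoints

variable {d : ℕ} {v : ℕ → Fin d → ℤ} {ε : ℝ}

lemma obsPoint_sub (v : ℕ → Fin d → ℤ) (ε : ℝ) (x : ℕ → EuclideanSpace ℝ (Fin d)) (i j : ℕ) :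
    obsPoint v ε x i - obsPoint v ε x j = latticePoint (v i - v j) + ε • (x i - x j) := by
  ext k
  simp only [obsPoint, latticePoint, PiLp.sub_apply, PiLp.add_apply, PiLp.smul_apply, smul_eq_mul,
    Pi.sub_apply, Int.cast_sub]
  ring

lemma mem_diffSet {S : Set (EuclideanSpace ℝ (Fin d))} {t : EuclideanSpace ℝ (Fin d)} :
    t ∈ diffSet S ε ↔
      ∃ u ≠ 0, ∃ s₁ ∈ S, ∃ s₂ ∈ S, latticePoint u + ε • (s₁ - s₂) = t := by
  simp only [diffSet, Set.mem_iUnion₂, Set.mem_vadd_set, Set.mem_smul_set, Set.mem_sub,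
    vadd_eq_add, Set.mem_ofPred_eq, exists_prop]
  constructor
  · rintro ⟨u, hu, _, ⟨_, ⟨s₁, h₁, s₂, h₂, rfl⟩, rfl⟩, rfl⟩
    exact ⟨u, hu, s₁, h₁, s₂, h₂, rfl⟩
  · rintro ⟨u, hu, s₁, h₁, s₂, h₂, rfl⟩
    exact ⟨u, hu, _, ⟨_, ⟨s₁, h₁, s₂, h₂, rfl⟩, rfl⟩, rfl⟩

lemma mul_abs_le_abs_add {ε x : ℝ} (m : ℤ) (hx : |x| ≤ 2) :
    (1 - 2 * |ε|) * |(m : ℝ)| ≤ |m + ε * x| := by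
  rcases eq_or_ne m 0 with rfl | hm
  · rw [Int.cast_zero, abs_zero, mul_zero]
    exact abs_nonneg _
  · have hm1 : (1 : ℝ) ≤ |(m : ℝ)| := by exact_mod_cast Int.one_le_abs hm
    have hεx : |ε * x| ≤ 2 * |ε| * |(m : ℝ)| := by
      rw [abs_mul]
      nlinarith [abs_nonneg ε, mul_le_mul_of_nonneg_left hx (abs_nonneg ε)]
    have := abs_sub_abs_le_abs_sub (m : ℝ) (-(ε * x))
    rw [abs_neg, sub_neg_eq_add] at this
    linarith

lemma isSeparated_obsPoint (hv : Function.Injective v) (hε : |ε| < 1 / 2)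
    {x : ℕ → EuclideanSpace ℝ (Fin d)} (hx : ∀ i k, x i k ∈ Set.Icc (-1) 1) (n : ℕ) :
    IsSeparated (1 - 2 * |ε|) (fun i : Fin n => v i) (fun i : Fin n => obsPoint v ε x i) where
  injective := hv.comp Fin.val_injective
  le_norm_sub i j := by
    have hδ : 0 < 1 - 2 * |ε| := by linarith
    rw [← le_div_iff₀' hδ, obsPoint_sub]
    refine (pi_norm_le_iff_of_nonneg (by positivity)).2 fun k => ?_
    rw [le_div_iff₀' hδ, Int.norm_eq_abs]
    have hxk : |x i k - x j k| ≤ 2 :=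
      abs_le.2 ⟨by linarith [(hx i k).1, (hx j k).2], by linarith [(hx i k).2, (hx j k).1]⟩
    exact (mul_abs_le_abs_add ((v i - v j) k) hxk).trans
      (PiLp.norm_apply_le (latticePoint (v i - v j) + ε • (x i - x j)) k)

end ObservationPoints

section MeanSquareSeparation

variable {d : ℕ} {v : ℕ → Fin d → ℤ} {ε : ℝ} {k : EuclideanSpace ℝ (Fin d) → ℝ}

lemma integral_prod_pos_of_mem_support {E : Type*} [TopologicalSpace E] [SecondCountableTopology E]
    [MeasurableSpace E] [BorelSpace E] {L : Measure E} [SFinite L] {f : E × E → ℝ}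
    (hf : Continuous f) (hf0 : ∀ z, 0 ≤ f z) (hint : Integrable f (L.prod L)) {s₁ s₂ : E}
    (h₁ : s₁ ∈ L.support) (h₂ : s₂ ∈ L.support) (hne : f (s₁, s₂) ≠ 0) :
    0 < ∫ z, f z ∂L.prod L := by
  rw [integral_pos_iff_support_of_nonneg hf0 hint]
  obtain ⟨A, hA, B, hB, hAB⟩ := mem_nhds_prod_iff.1
    (hf.isOpen_support.mem_nhds (Function.mem_support.2 hne))
  refine lt_of_lt_of_le ?_ (measure_mono hAB)
  rw [Measure.prod_prod]
  exact ENNReal.mul_pos (Measure.mem_support_iff_forall _ |>.1 h₁ A hA).ne'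
    (Measure.mem_support_iff_forall _ |>.1 h₂ B hB).ne'

lemma mul_card_le_sum_sum_sq_kernelMatrix {ι E : Type*} [Fintype ι] [AddGroup E] (k : E → ℝ)
    (z : ι → E) : k 0 ^ 2 * Fintype.card ι ≤ ∑ i, ∑ j, kernelMatrix k z i j ^ 2 := by
  calc k 0 ^ 2 * Fintype.card ι = ∑ i, kernelMatrix k z i i ^ 2 := by
        simp [kernelMatrix, mul_comm]
    _ ≤ _ := Finset.sum_le_sum fun i _ =>
        Finset.single_le_sum (f := fun j => kernelMatrix k z i j ^ 2) (fun _ _ => sq_nonneg _)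
          (Finset.mem_univ i)

variable {Ω : Type*} [MeasurableSpace Ω] {P : Measure Ω} {L : Measure (EuclideanSpace ℝ (Fin d))}
  {X : ℕ → Ω → EuclideanSpace ℝ (Fin d)}

lemma measure_sum_sq_covMatrix_lt_le [IsProbabilityMeasure P] (hv : Function.Injective v)
    (hX : ∀ i, HasLaw (X i) L P) (hind : iIndepFun X P) {u : Fin d → ℤ}
    (hu : u ≠ 0) {f : EuclideanSpace ℝ (Fin d) × EuclideanSpace ℝ (Fin d) → ℝ}
    (hf : Measurable f) (hf01 : ∀ z, f z ∈ Set.Icc (0 : ℝ) 1)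
    (hfk : ∀ z, f z ≤ k (latticePoint u + ε • (z.1 - z.2)) ^ 2)
    (hpos : 0 < ∫ z, f z ∂L.prod L) {n : ℕ} (hn : 0 < n)
    (hcard : n ≤ 4 ^ d * (Finset.univ.filter fun q : Fin n × Fin n => v q.1 - v q.2 = u).card) :
    P {ω | ∑ i, ∑ j, covMatrix k v ε (X · ω) n i j ^ 2 < (∫ z, f z ∂L.prod L) / 2 / 4 ^ d * n} ≤
      ENNReal.ofReal (16 / (∫ z, f z ∂L.prod L) ^ 2 * 4 ^ d / n) := by
  set q := ∫ z, f z ∂L.prod L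
  set J := Finset.univ.filter fun q : Fin n × Fin n => v q.1 - v q.2 = u
  have hJ_eq {r : Fin n × Fin n} (hr : r ∈ J) : v r.1 - v r.2 = u := (Finset.mem_filter.1 hr).2
  have hJ : 0 < J.card := Nat.pos_of_mul_pos_left (hn.trans_le hcard)
  have hcard' : (n : ℝ) ≤ 4 ^ d * J.card := by exact_mod_cast hcard
  have hv' : Function.Injective fun i : Fin n => v i := hv.comp Fin.val_injective
  have hdev := measure_sum_pair_le (fun i : Fin n => hX i) (hind.precomp Fin.val_injective) hf hf01
    hpos (Finset.card_pos.1 hJ) (fun r hr h => hu (by rw [← hJ_eq hr, h, sub_self]))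
    (fun r hr r' hr' h => Prod.ext h (hv' (sub_right_injective
      ((hJ_eq hr).trans (by rw [← hJ_eq hr', h])))))
    (fun r hr r' hr' h => Prod.ext (hv' (sub_left_injective
      ((hJ_eq hr).trans (by rw [← hJ_eq hr', h])))) h)
  have hsum (ω : Ω) : ∑ r ∈ J, f (X r.1 ω, X r.2 ω) ≤
      ∑ i, ∑ j, covMatrix k v ε (X · ω) n i j ^ 2 := by
    rw [← Fintype.sum_prod_type' fun i j => covMatrix k v ε (X · ω) n i j ^ 2]
    refine (Finset.sum_le_sum fun r hr => ?_).trans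
      (Finset.sum_le_univ_sum_of_nonneg fun _ => sq_nonneg _)
    rw [covMatrix, Matrix.of_apply, obsPoint_sub, hJ_eq hr]
    exact hfk _
  have hthreshold : q / 2 / 4 ^ d * n ≤ q / 2 * J.card := by
    rw [div_mul_eq_mul_div, div_le_iff₀ (by positivity), mul_assoc, mul_comm (J.card : ℝ)]
    gcongr
  have hbound : 16 / q ^ 2 / J.card ≤ 16 / q ^ 2 * 4 ^ d / n := by
    rw [div_le_div_iff₀ (by positivity) (by positivity), mul_assoc]
    gcongr
  exact (measure_mono fun ω hω => (hsum ω).trans (hω.le.trans hthreshold)).trans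
    (hdev.trans (ENNReal.ofReal_le_ofReal hbound))

lemma exists_tendsto_measure_sum_sq_lt_of_mem_diffSet [IsProbabilityMeasure P]
    (hv : IsGridSequence v) (hd : 1 ≤ d) (hX : ∀ i, HasLaw (X i) L P) (hind : iIndepFun X P)
    (hk : Continuous k) {t : EuclideanSpace ℝ (Fin d)} (ht : t ∈ diffSet L.support ε)
    (hkt : k t ≠ 0) :
    ∃ κ > 0, Tendsto (fun n : ℕ => P {ω | ∑ i, ∑ j,
      covMatrix k v ε (X · ω) n i j ^ 2 < κ * n}) atTop (𝓝 0) := by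
  have : IsProbabilityMeasure L :=
    (hX 0).map_eq ▸ Measure.isProbabilityMeasure_map (hX 0).aemeasurable
  obtain ⟨u, hu, s₁, h₁, s₂, h₂, rfl⟩ := mem_diffSet.1 ht
  let f : EuclideanSpace ℝ (Fin d) × EuclideanSpace ℝ (Fin d) → ℝ := fun z =>
    min 1 (k (latticePoint u + ε • (z.1 - z.2)) ^ 2)
  have hf : Continuous f := by fun_prop
  have hf01 (z) : f z ∈ Set.Icc (0 : ℝ) 1 :=
    ⟨le_min zero_le_one (sq_nonneg _), min_le_left _ _⟩
  set q := ∫ z, f z ∂L.prod L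
  have hqpos : 0 < q := integral_prod_pos_of_mem_support hf (fun z => (hf01 z).1)
    ((memLp_of_mem_Icc_zero_one hf.aemeasurable hf01 1).integrable le_rfl) h₁ h₂
    (lt_min one_pos (by positivity)).ne'
  have hbound : Tendsto (fun n : ℕ => ENNReal.ofReal (16 / q ^ 2 * 4 ^ d / n)) atTop (𝓝 0) := by
    rw [← ENNReal.ofReal_zero]
    exact ENNReal.tendsto_ofReal (tendsto_const_div_atTop_nhds_zero_nat _)
  refine ⟨q / 2 / 4 ^ d, by positivity, tendsto_of_tendsto_of_tendsto_of_le_of_le'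
    tendsto_const_nhds hbound (Eventually.of_forall fun _ => zero_le) ?_⟩
  filter_upwards [hv.le_card_sub_eq hd u, eventually_gt_atTop 0] with n hcard hn
  exact measure_sum_sq_covMatrix_lt_le (hv.injective hd) hX hind hu hf.measurable hf01
    (fun z => min_le_right _ _) hqpos hn hcard

lemma exists_tendsto_measure_sum_sq_lt [IsProbabilityMeasure P] (hv : IsGridSequence v)
    (hd : 1 ≤ d) (hX : ∀ i, HasLaw (X i) L P) (hind : iIndepFun X P) (hk : Continuous k)
    {t : EuclideanSpace ℝ (Fin d)} (ht : t ∈ insert 0 (diffSet L.support ε)) (hkt : k t ≠ 0) :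
    ∃ κ > 0, Tendsto (fun n : ℕ => P {ω | ∑ i, ∑ j,
      covMatrix k v ε (X · ω) n i j ^ 2 < κ * n}) atTop (𝓝 0) := by
  obtain rfl | ht := Set.mem_insert_iff.1 ht
  · refine ⟨k 0 ^ 2, by positivity, tendsto_const_nhds.congr fun n => ?_⟩
    have hle (ω : Ω) : k 0 ^ 2 * n ≤ ∑ i, ∑ j, covMatrix k v ε (X · ω) n i j ^ 2 := by
      have h := mul_card_le_sum_sum_sq_kernelMatrix k fun i : Fin n => obsPoint v ε (X · ω) i
      rwa [Fintype.card_fin] at h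
    simp only [(hle _).not_gt, Set.ofPred_false, measure_empty]
  · exact exists_tendsto_measure_sum_sq_lt_of_mem_diffSet hv hd hX hind hk ht hkt

end MeanSquareSeparation

section MEstimation

variable {Ω ι Ξ : Type*} [MeasurableSpace Ω] {P : Measure Ω} [PseudoEMetricSpace Ξ] {Θ : Set Ξ}
  {θ₀ : Ξ} {l : Filter ι} {M : ι → Ξ → Ω → ℝ} {W : ι → Ω → ℝ} {T : ι → Ω → Ξ}

lemma tendstoInMeasure_of_forall_gap (hΘ : IsCompact Θ)
    (hT : ∀ᶠ n in l, ∀ᵐ ω ∂P, T n ω ∈ Θ ∧ M n (T n ω) ω ≤ M n θ₀ ω)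
    (hgap : ∀ θ ∈ Θ, θ ≠ θ₀ →
      ∃ δ > 0, Tendsto (fun n => P {ω | M n θ ω - M n θ₀ ω ≤ δ}) l (𝓝 0))
    (hW : ∀ η > 0, ∃ B, ∀ᶠ n in l, P {ω | B < W n ω} ≤ η)
    (hequi : ∀ B, ∀ θ ∈ Θ, ∀ δ > 0, ∃ U ∈ 𝓝[Θ] θ, ∀ᶠ n in l, ∀ᵐ ω ∂P,
      W n ω ≤ B → ∀ θ' ∈ U ∩ Θ, M n θ ω - M n θ' ω ≤ δ) :
    TendstoInMeasure P T l fun _ => θ₀ := by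
  intro α hα
  refine ENNReal.tendsto_nhds_zero.2 fun η hη => ?_
  obtain ⟨B, hB⟩ := hW (η / 2) (ENNReal.half_pos hη.ne')
  have hne : ∀ θ ∈ Θ ∩ {θ | α ≤ edist θ θ₀}, θ ≠ θ₀ := by
    rintro θ ⟨-, h⟩ rfl
    exact (h.trans (edist_self θ).le).not_gt hα
  choose! δ hδ hδlim using fun θ hθ => hgap θ (Set.mem_of_mem_inter_left hθ) (hne θ hθ)
  choose! U hU hUM using fun θ hθ => hequi B θ (Set.mem_of_mem_inter_left hθ) (δ θ) (hδ θ hθ)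
  have hcompact : IsCompact (Θ ∩ {θ | α ≤ edist θ θ₀}) :=
    hΘ.inter_right (isClosed_le continuous_const (continuous_id.edist continuous_const))
  obtain ⟨t, ht, hcover⟩ := hcompact.elim_nhdsWithin_subcover U fun θ hθ =>
    nhdsWithin_mono θ Set.inter_subset_left (hU θ hθ)
  have hsum : Tendsto (fun n => ∑ θ ∈ t, P {ω | M n θ ω - M n θ₀ ω ≤ δ θ}) l (𝓝 0) := by
    simpa only [Finset.sum_const_zero] using
      tendsto_finsetSum t fun θ hθ => hδlim θ (ht θ hθ)
  filter_upwards [hT, hB, ENNReal.tendsto_nhds_zero.1 hsum (η / 2) (ENNReal.half_pos hη.ne'),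
    (eventually_all_finset t).2 fun θ hθ => hUM θ (ht θ hθ)] with n hTn hBn hsumn hUn
  calc P {ω | α ≤ edist (T n ω) θ₀}
      ≤ P ({ω | B < W n ω} ∪ ⋃ θ ∈ t, {ω | M n θ ω - M n θ₀ ω ≤ δ θ}) := by
        refine measure_mono_ae ?_
        filter_upwards [hTn, (eventually_all_finset t).2 hUn] with ω hTω hUω hω
        refine or_iff_not_imp_left.2 fun hWω => ?_
        obtain ⟨θ, hθt, hθU⟩ := Set.mem_iUnion₂.1 (hcover ⟨hTω.1, hω⟩)
        refine Set.mem_iUnion₂.2 ⟨θ, hθt, ?_⟩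
        have hlocal := hUω θ hθt (not_lt.1 hWω) _ ⟨hθU, hTω.1⟩
        exact (sub_le_sub_left hTω.2 _).trans hlocal
    _ ≤ η / 2 + η / 2 := (measure_union_le _ _).trans
        (add_le_add hBn ((measure_biUnion_finset_le _ _).trans hsumn))
    _ = η := ENNReal.add_halves η

end MEstimation

section Consistency

lemma aemeasurable_negLogLik {Ω : Type*} [MeasurableSpace Ω] {P : Measure Ω} {n : ℕ}
    {R : Ω → Matrix (Fin n) (Fin n) ℝ} {y : Ω → Fin n → ℝ}
    (hR : ∀ i j, AEMeasurable (fun ω => R ω i j) P) (hy : AEMeasurable y P) :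
    AEMeasurable (fun ω => negLogLik (R ω) (y ω)) P := by
  have hRy : AEMeasurable (fun ω => ((fun i j => R ω i j : Fin n → Fin n → ℝ), y ω)) P :=
    (aemeasurable_pi_iff.2 fun i => aemeasurable_pi_iff.2 (hR i)).prodMk hy
  have hof : Continuous fun q : (Fin n → Fin n → ℝ) × (Fin n → ℝ) => Matrix.of q.1 :=
    continuous_fst
  have hdet : AEMeasurable (fun ω => (R ω).det) P :=
    hof.matrix_det.measurable.comp_aemeasurable hRy
  have hadj : AEMeasurable (fun ω => y ω ⬝ᵥ (R ω).adjugate *ᵥ y ω) P :=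
    (continuous_snd.dotProduct (hof.matrix_adjugate.matrix_mulVec
      continuous_snd)).measurable.comp_aemeasurable hRy
  have hinv (ω : Ω) : negLogLik (R ω) (y ω) = (1 / (n : ℝ)) *
      (Real.log (R ω).det + ((R ω).det)⁻¹ * (y ω ⬝ᵥ (R ω).adjugate *ᵥ y ω)) := by
    rw [negLogLik, Matrix.inv_def, Ring.inverse_eq_inv', smul_mulVec, dotProduct_smul, smul_eq_mul]
  simp only [hinv]
  exact (hdet.log.add (hdet.inv.mul hadj)).const_mul _

/-- `Y` is a centered Gaussian process, stationary with covariance function `k`. -/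
structure IsStationaryGaussianProcess {E Ω : Type*} [Sub E] [MeasurableSpace Ω] (Y : E → Ω → ℝ)
    (k : E → ℝ) (P : Measure Ω) : Prop where
  isGaussianProcess : IsGaussianProcess Y P
  integral_eq_zero : ∀ t, P[Y t] = 0
  covariance_eq : ∀ s t, cov[Y s, Y t; P] = k (s - t)

lemma IsStationaryGaussianProcess.hasCenteredGaussianLaw {E Ω ι : Type*} [Finite ι] [Sub E]
    [MeasurableSpace Ω] {Y : E → Ω → ℝ} {k : E → ℝ} {P : Measure Ω}
    (hY : IsStationaryGaussianProcess Y k P) (z : ι → E) :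
    HasCenteredGaussianLaw (fun i => Y (z i)) (kernelMatrix k z) P where
  hasGaussianLaw := by
    cases nonempty_fintype ι
    exact ((hY.isGaussianProcess.comp_right z).hasGaussianLaw Finset.univ).map_fun
      (ContinuousLinearMap.pi fun i =>
        ContinuousLinearMap.proj (⟨i, Finset.mem_univ i⟩ : (Finset.univ : Finset ι)))
  integral_eq_zero i := hY.integral_eq_zero (z i)
  covariance_eq i j := hY.covariance_eq (z i) (z j)

lemma SpectralModel.eventually_negLogLik_sub_le {d : ℕ} {Ξ : Type*} [TopologicalSpace Ξ]
    {Θ : Set Ξ} {K φ : Ξ → EuclideanSpace ℝ (Fin d) → ℝ} {θ : Ξ} (hK : SpectralModel Θ K φ)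
    (hΘ : IsCompact Θ) (hθ : θ ∈ Θ) {ρ δ : ℝ} (hρ : 0 < ρ) (hδ : 0 < δ) (B : ℝ) :
    ∀ᶠ θ' in 𝓝[Θ] θ, ∀ (n : ℕ) (w : Fin n → Fin d → ℤ) (z : Fin n → EuclideanSpace ℝ (Fin d))
      (y : Fin n → ℝ), 0 < n → IsSeparated ρ w z → (1 / (n : ℝ)) * (y ⬝ᵥ y) ≤ B →
        negLogLik (kernelMatrix (K θ) z) y - negLogLik (kernelMatrix (K θ') z) y ≤ δ := by
  obtain ⟨c, hc, hlow⟩ := hK.exists_smul_one_le hΘ hρ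
  set κ := δ / (1 / c + |B| / c ^ 2) with hκ_def
  have hκ : 0 < κ := by positivity
  filter_upwards [hK.eventually_kernelMatrix_le_add hθ hρ hκ, self_mem_nhdsWithin]
    with θ' hclose hθ' n w z y hn hz hy
  obtain ⟨hle, hle'⟩ := hclose n w z hz
  calc negLogLik (kernelMatrix (K θ) z) y - negLogLik (kernelMatrix (K θ') z) y
      ≤ κ / c + κ / c ^ 2 * ((1 / n) * (y ⬝ᵥ y)) :=
        negLogLik_sub_le hn hc hκ.le (hlow θ' hθ' n w z hz) (hlow θ hθ n w z hz) hle hle' y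
    _ ≤ κ / c + κ / c ^ 2 * |B| := by gcongr; exact hy.trans (le_abs_self B)
    _ = δ := by rw [hκ_def]; field_simp

variable {d : ℕ} {ΩX ΩY : Type*} [MeasurableSpace ΩX] [MeasurableSpace ΩY] {PX : Measure ΩX}
  {PY : Measure ΩY} {v : ℕ → Fin d → ℤ} {ε : ℝ} {L : Measure (EuclideanSpace ℝ (Fin d))}
  {X : ℕ → ΩX → EuclideanSpace ℝ (Fin d)} {Y : EuclideanSpace ℝ (Fin d) → ΩY → ℝ}

lemma aemeasurable_negLogLik_obs [SFinite PY] {k : EuclideanSpace ℝ (Fin d) → ℝ}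
    (hk : Continuous k) (hX : ∀ i, AEMeasurable (X i) PX) {n : ℕ}
    (hobs : AEMeasurable (obs v ε X Y n) (PX.prod PY)) :
    AEMeasurable (fun ω => negLogLik (covMatrix k v ε (X · ω.1) n) (obs v ε X Y n ω))
      (PX.prod PY) := by
  have hpoint (i : ℕ) :
      AEMeasurable (fun ω : ΩX × ΩY => obsPoint v ε (X · ω.1) i) (PX.prod PY) :=
    ((hX i).comp_fst.const_smul ε).const_add _
  exact aemeasurable_negLogLik (fun i j =>
    hk.measurable.comp_aemeasurable ((hpoint i).sub (hpoint j))) hobs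

lemma ae_isSeparated_obsPoint (hv : Function.Injective v) (hε : |ε| < 1 / 2)
    (hX : ∀ i, HasLaw (X i) L PX) (hL : L.support ⊆ {t | ∀ k, t k ∈ Set.Icc (-1) 1}) :
    ∀ᵐ ω ∂PX, ∀ n, IsSeparated (1 - 2 * |ε|) (fun i : Fin n => v i)
      (fun i : Fin n => obsPoint v ε (X · ω) i) := by
  have hmem : ∀ᵐ ω ∂PX, ∀ i, X i ω ∈ L.support := ae_all_iff.2 fun i =>
    ae_of_ae_map (hX i).aemeasurable ((hX i).map_eq ▸ Measure.support_mem_ae)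
  filter_upwards [hmem] with ω hω
  exact isSeparated_obsPoint hv hε fun i => hL (hω i)

variable [IsProbabilityMeasure PX] [IsProbabilityMeasure PY]

lemma measure_lt_mean_sq_obs_le {k : EuclideanSpace ℝ (Fin d) → ℝ}
    (hY : IsStationaryGaussianProcess Y k PY) {n : ℕ}
    (hobs : AEMeasurable (obs v ε X Y n) (PX.prod PY)) {B : ℝ} (hB : 0 < B) :
    PX.prod PY {ω | B < (1 / (n : ℝ)) * (obs v ε X Y n ω ⬝ᵥ obs v ε X Y n ω)} ≤
      ENNReal.ofReal (k 0 / B) := by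
  have hmean : AEMeasurable (fun ω => (1 / (n : ℝ)) * (obs v ε X Y n ω ⬝ᵥ obs v ε X Y n ω))
      (PX.prod PY) :=
    ((continuous_id.dotProduct continuous_id).measurable.comp_aemeasurable hobs).const_mul _
  have hL2 (t : EuclideanSpace ℝ (Fin d)) : MemLp (Y t) 2 PY :=
    (hY.isGaussianProcess.hasGaussianLaw_eval t).memLp_two
  have hvar (t : EuclideanSpace ℝ (Fin d)) : ∫ ω, Y t ω ^ 2 ∂PY = k 0 := by
    simpa [kernelMatrix] using (hY.hasCenteredGaussianLaw fun _ : Unit => t).integral_sq ()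
  refine (measure_prod_le_of_sections (c := ENNReal.ofReal (k 0 / B))
    (nullMeasurableSet_lt aemeasurable_const hmean) ∅ (ae_of_all _ fun ω _ => ?_)).trans_eq ?_
  · simpa only [obs, dotProduct, ← sq, Set.preimage_ofPred_eq] using
      measure_lt_mean_sq_le (hvar 0 ▸ integral_nonneg fun _ => sq_nonneg _) hB
        (fun i : Fin n => hL2 (obsPoint v ε (X · ω) i)) fun i => (hvar _).le
  · rw [measure_empty, zero_add]

lemma exists_measure_lt_mean_sq_obs_le {k : EuclideanSpace ℝ (Fin d) → ℝ}
    (hY : IsStationaryGaussianProcess Y k PY)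
    (hobs : ∀ n, AEMeasurable (obs v ε X Y n) (PX.prod PY)) {η : ENNReal} (hη : 0 < η) :
    ∃ B : ℝ, ∀ n : ℕ, PX.prod PY
      {ω | B < (1 / (n : ℝ)) * (obs v ε X Y n ω ⬝ᵥ obs v ε X Y n ω)} ≤ η := by
  have hlim : Tendsto (fun B : ℝ => ENNReal.ofReal (k 0 / B)) atTop (𝓝 0) := by
    rw [← ENNReal.ofReal_zero]
    exact ENNReal.tendsto_ofReal (tendsto_const_nhds.div_atTop tendsto_id)
  obtain ⟨B, hB, hBη⟩ :=
    ((eventually_gt_atTop 0).and (ENNReal.tendsto_nhds_zero.1 hlim η hη)).exists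
  exact ⟨B, fun n => (measure_lt_mean_sq_obs_le hY (hobs n) hB).trans hBη⟩

variable {Ξ : Type*} [TopologicalSpace Ξ] {Θ : Set Ξ}
  {K φ : Ξ → EuclideanSpace ℝ (Fin d) → ℝ} {θ₀ θ : Ξ}

lemma SpectralModel.exists_tendsto_measure_negLogLik_sub_le (hK : SpectralModel Θ K φ)
    (hΘ : IsCompact Θ) (hθ₀ : θ₀ ∈ Θ) (hθ : θ ∈ Θ) (hd : 1 ≤ d) (hv : IsGridSequence v)
    (hε : |ε| < 1 / 2) (hX : ∀ i, HasLaw (X i) L PX) (hind : iIndepFun X PX)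
    (hL : L.support ⊆ {t | ∀ k, t k ∈ Set.Icc (-1) 1})
    (hY : IsStationaryGaussianProcess Y (K θ₀) PY)
    (hobs : ∀ n, AEMeasurable (obs v ε X Y n) (PX.prod PY))
    (hne : ∃ t ∈ insert 0 (diffSet L.support ε), K θ t ≠ K θ₀ t) :
    ∃ δ > 0, Tendsto (fun n : ℕ => PX.prod PY {ω |
      negLogLik (covMatrix (K θ) v ε (X · ω.1) n) (obs v ε X Y n ω) -
        negLogLik (covMatrix (K θ₀) v ε (X · ω.1) n) (obs v ε X Y n ω) ≤ δ}) atTop (𝓝 0) := by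
  obtain ⟨t, ht, hkt⟩ := hne
  have hδε : 0 < 1 - 2 * |ε| := by linarith
  have hcont := hK.continuous_kernel hθ
  have hcont₀ := hK.continuous_kernel hθ₀
  have hXm (i : ℕ) := (hX i).aemeasurable
  obtain ⟨c, hc, hlow⟩ := hK.exists_smul_one_le hΘ hδε
  obtain ⟨C, hC, hup⟩ := hK.exists_le_smul_one hδε
  obtain ⟨κ, hκ, hfar⟩ := exists_tendsto_measure_sum_sq_lt hv hd hX hind (hcont.sub hcont₀) ht
    (sub_ne_zero.2 hkt)
  obtain ⟨δ, hδ, V, hgap⟩ := exists_measure_negLogLik_sub_le (P := PY) hc hC hκ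
  have hVn : Tendsto (fun n : ℕ => ENNReal.ofReal (V / n)) atTop (𝓝 0) := by
    rw [← ENNReal.ofReal_zero]
    exact ENNReal.tendsto_ofReal (tendsto_const_div_atTop_nhds_zero_nat _)
  refine ⟨δ, hδ, tendsto_of_tendsto_of_tendsto_of_le_of_le' tendsto_const_nhds
    (by simpa only [add_zero] using hfar.add hVn) (Eventually.of_forall fun _ => zero_le) ?_⟩
  filter_upwards [eventually_gt_atTop 0] with n hn
  have hmeas : NullMeasurableSet {ω |
      negLogLik (covMatrix (K θ) v ε (X · ω.1) n) (obs v ε X Y n ω) -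
        negLogLik (covMatrix (K θ₀) v ε (X · ω.1) n) (obs v ε X Y n ω) ≤ δ} (PX.prod PY) :=
    nullMeasurableSet_le ((aemeasurable_negLogLik_obs hcont hXm (hobs n)).sub
      (aemeasurable_negLogLik_obs hcont₀ hXm (hobs n))) aemeasurable_const
  refine measure_prod_le_of_sections hmeas _ ?_
  filter_upwards [ae_isSeparated_obsPoint (hv.injective hd) hε hX hL] with ω hω hfarω
  let R (θ : Ξ) := covMatrix (K θ) v ε (X · ω) n
  exact hgap n hn (fun i => Y (obsPoint v ε (X · ω) i)) (R θ₀) (R θ)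
    (hY.hasCenteredGaussianLaw fun i : Fin n => obsPoint v ε (X · ω) i)
    (hlow θ₀ hθ₀ n _ _ (hω n)) (hlow θ hθ n _ _ (hω n)) (hup θ₀ hθ₀ n _ _ (hω n))
    (hup θ hθ n _ _ (hω n)) (not_lt.1 hfarω)

end Consistency

section RegularModel

lemma dist_le_sum_of_dist_update_le {ι M : Type*} {α : ι → Type*} [Fintype ι] [DecidableEq ι]
    [PseudoMetricSpace M] {S : ∀ i, Set (α i)} {g : (∀ i, α i) → M} {B : ∀ i, α i → α i → ℝ}
    (hg : ∀ i, ∀ x ∈ Set.univ.pi S, ∀ s ∈ S i, dist (g (Function.update x i s)) (g x) ≤ B i s (x i))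
    {x y : ∀ i, α i} (hx : x ∈ Set.univ.pi S) (hy : y ∈ Set.univ.pi S) :
    dist (g y) (g x) ≤ ∑ i, B i (y i) (x i) := by
  have hpiecewise (F : Finset ι) : F.piecewise y x ∈ Set.univ.pi S := fun i _ => by
    by_cases hi : i ∈ F
    · simpa only [Finset.piecewise_eq_of_mem _ _ _ hi] using hy i trivial
    · simpa only [Finset.piecewise_eq_of_notMem _ _ _ hi] using hx i trivial
  suffices ∀ F : Finset ι, dist (g (F.piecewise y x)) (g x) ≤ ∑ i ∈ F, B i (y i) (x i) by
    simpa only [Finset.piecewise_univ] using this Finset.univ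
  intro F
  induction F using Finset.induction_on with
  | empty => simp
  | insert i F hi ih =>
    rw [Finset.sum_insert hi, Finset.piecewise_insert]
    have hstep := hg i _ (hpiecewise F) (y i) (hy i trivial)
    rw [Finset.piecewise_eq_of_notMem _ _ _ hi] at hstep
    exact (dist_triangle _ _ _).trans (add_le_add hstep ih)

variable {d p : ℕ} {a b : ℝ} {K : (Fin p → ℝ) → EuclideanSpace ℝ (Fin d) → ℝ}
  {θ : Fin p → ℝ}

lemma paramSet_eq_pi : paramSet p a b = Set.univ.pi fun _ => Set.Icc a b :=
  (Set.pi_univ_Icc _ _).symm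

lemma update_mem_paramSet (hθ : θ ∈ paramSet p a b) {s : ℝ} (hs : s ∈ Set.Icc a b) (i : Fin p) :
    Function.update θ i s ∈ paramSet p a b := by
  rw [paramSet_eq_pi] at hθ ⊢
  exact (Set.update_mem_pi_iff_of_mem hθ).2 fun _ => hs

lemma RegularModel.exists_abs_kernel_update_sub_le (hK : RegularModel a b K) (i : Fin p) :
    ∃ C, ∀ θ ∈ paramSet p a b, ∀ s ∈ Set.Icc a b, ∀ t,
      |K (Function.update θ i s) t - K θ t| ≤ C * |s - θ i| / (1 + ‖t‖ ^ (d + 1)) := by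
  obtain ⟨C, hC⟩ := hK.bound [i] (by simp)
  refine ⟨C, fun θ hθ s hs t => ?_⟩
  have hmean := (convex_Icc a b).norm_image_sub_le_of_norm_derivWithin_le
    (f := fun u => K (Function.update θ i u) t) (C := C / (1 + ‖t‖ ^ (d + 1)))
    (fun u hu => ?_) (fun u hu => ?_) ⟨hθ.1 i, hθ.2 i⟩ hs
  · simpa [div_mul_eq_mul_div] using hmean
  · simpa [iterParamPartial] using
      hK.differentiable [] (by simp) i _ (update_mem_paramSet hθ hu i) t
  · simpa [iterParamPartial, paramPartial] using hC _ (update_mem_paramSet hθ hu i) t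

lemma RegularModel.eventually_abs_kernel_sub_le (hK : RegularModel a b K)
    (hθ : θ ∈ paramSet p a b) {η : ℝ} (hη : 0 < η) :
    ∀ᶠ θ' in 𝓝[paramSet p a b] θ, ∀ t, |K θ' t - K θ t| ≤ η / (1 + ‖t‖ ^ (d + 1)) := by
  choose C hC using hK.exists_abs_kernel_update_sub_le
  have hlim : Tendsto (fun θ' : Fin p → ℝ => ∑ i, C i * |θ' i - θ i|) (𝓝 θ) (𝓝 0) :=
    Continuous.tendsto' (by fun_prop) _ _ (by simp)
  filter_upwards [nhdsWithin_le_nhds (hlim.eventually_le_const hη), self_mem_nhdsWithin]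
    with θ' hsum hθ' t
  rw [paramSet_eq_pi] at hθ hθ' hC
  calc |K θ' t - K θ t| ≤ ∑ i, C i * |θ' i - θ i| / (1 + ‖t‖ ^ (d + 1)) :=
        dist_le_sum_of_dist_update_le (g := fun θ => K θ t)
          (B := fun i s r => C i * |s - r| / (1 + ‖t‖ ^ (d + 1)))
          (fun i θ hθ s hs => hC i θ hθ s hs t) hθ hθ'
    _ ≤ η / (1 + ‖t‖ ^ (d + 1)) := by rw [← Finset.sum_div]; gcongr

lemma RegularModel.eq_cosTransform (hK : RegularModel a b K) (hθ : θ ∈ paramSet p a b) :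
    K θ = cosTransform fun f => (fourierTransform (K θ) f).re := by
  funext t
  have hint : Integrable fun f => fourierTransform (K θ) f *
      Complex.exp (Complex.I * (inner ℝ f t : ℝ)) := by
    refine (hK.integrable_fourier θ hθ).mul_bdd (c := 1)
      (Continuous.aestronglyMeasurable (by fun_prop)) (ae_of_all _ fun f => ?_)
    rw [mul_comm, Complex.norm_exp_ofReal_mul_I]
  have hre (f : EuclideanSpace ℝ (Fin d)) :
      (fourierTransform (K θ) f * Complex.exp (Complex.I * (inner ℝ f t : ℝ))).re =
        (fourierTransform (K θ) f).re * Real.cos (inner ℝ f t) := by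
    rw [Complex.mul_re, (hK.fourier_pos θ hθ f).2, zero_mul, sub_zero, mul_comm Complex.I,
      Complex.exp_ofReal_mul_I_re]
  calc K θ t = (K θ t : ℂ).re := (Complex.ofReal_re _).symm
    _ = ∫ f, (fourierTransform (K θ) f * Complex.exp (Complex.I * (inner ℝ f t : ℝ))).re := by
        rw [hK.inversion θ hθ t]
        exact (integral_re hint).symm
    _ = cosTransform (fun f => (fourierTransform (K θ) f).re) t := by
        simp only [hre, cosTransform]

lemma RegularModel.spectralModel (hK : RegularModel a b K) :
    SpectralModel (paramSet p a b) K fun θ f => (fourierTransform (K θ) f).re where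
  exists_abs_le := hK.bound [] (by simp)
  eventually_abs_sub_le _ hθ _ hη := hK.eventually_abs_kernel_sub_le hθ hη
  integrable θ hθ := (hK.integrable_fourier θ hθ).re
  eq_cosTransform _ hθ := hK.eq_cosTransform hθ
  continuousOn := Complex.continuous_re.comp_continuousOn hK.fourier_continuous
  pos θ hθ f := (hK.fourier_pos θ hθ f).1

end RegularModel

lemma latticePoint_mem_insert_diffSet {d : ℕ} {S : Set (EuclideanSpace ℝ (Fin d))}
    (hS : S.Nonempty) (ε : ℝ) (u : Fin d → ℤ) : latticePoint u ∈ insert 0 (diffSet S ε) := by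
  obtain ⟨s, hs⟩ := hS
  by_cases hu : u = 0
  · left
    ext k
    simp [hu, latticePoint]
  · right
    exact mem_diffSet.2 ⟨u, hu, s, hs, s, hs, by simp⟩

end PerturbedGrid

open PerturbedGrid in
theorem mainTheorem3_general {d : ℕ} {Ξ ΩX ΩY : Type*} [PseudoEMetricSpace Ξ]
    [MeasurableSpace ΩX] [MeasurableSpace ΩY] {PX : Measure ΩX} {PY : Measure ΩY}
    [IsProbabilityMeasure PX] [IsProbabilityMeasure PY] {Θ : Set Ξ}
    {K φ : Ξ → EuclideanSpace ℝ (Fin d) → ℝ} {θ₀ : Ξ} {v : ℕ → Fin d → ℤ} {ε : ℝ}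
    {L : Measure (EuclideanSpace ℝ (Fin d))} {X : ℕ → ΩX → EuclideanSpace ℝ (Fin d)}
    {Y : EuclideanSpace ℝ (Fin d) → ΩY → ℝ} {T : ℕ → ΩX × ΩY → Ξ} (hd : 1 ≤ d)
    (hΘ : IsCompact Θ) (hK : SpectralModel Θ K φ) (hθ₀ : θ₀ ∈ Θ) (hv : IsGridSequence v)
    (hε : |ε| < 1 / 2) (hL : L.support ⊆ {t | ∀ k, t k ∈ Set.Icc (-1) 1})
    (hX : ∀ i, HasLaw (X i) L PX) (hind : iIndepFun X PX)
    (hY : IsStationaryGaussianProcess Y (K θ₀) PY)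
    (hobs : ∀ n, AEMeasurable (obs v ε X Y n) (PX.prod PY))
    (hT : ∀ n, 1 ≤ n → ∀ᵐ ω ∂PX.prod PY, T n ω ∈ Θ ∧ ∀ θ ∈ Θ,
      negLogLik (covMatrix (K (T n ω)) v ε (X · ω.1) n) (obs v ε X Y n ω) ≤
        negLogLik (covMatrix (K θ) v ε (X · ω.1) n) (obs v ε X Y n ω))
    (hident : ∀ θ ∈ Θ, θ ≠ θ₀ → ∃ t ∈ insert 0 (diffSet L.support ε), K θ t ≠ K θ₀ t) :
    TendstoInMeasure (PX.prod PY) T atTop fun _ => θ₀ := by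
  have hseparated := (Measure.quasiMeasurePreserving_fst (μ := PX) (ν := PY)).ae
    (ae_isSeparated_obsPoint (hv.injective hd) hε hX hL)
  refine tendstoInMeasure_of_forall_gap (Θ := Θ)
    (M := fun n θ ω => negLogLik (covMatrix (K θ) v ε (X · ω.1) n) (obs v ε X Y n ω))
    (W := fun n ω => (1 / (n : ℝ)) * (obs v ε X Y n ω ⬝ᵥ obs v ε X Y n ω)) hΘ ?_ ?_ ?_ ?_
  · filter_upwards [eventually_ge_atTop 1] with n hn
    filter_upwards [hT n hn] with ω hω using ⟨hω.1, hω.2 θ₀ hθ₀⟩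
  · exact fun θ hθ hne => hK.exists_tendsto_measure_negLogLik_sub_le hΘ hθ₀ hθ hd hv hε hX hind
      hL hY hobs (hident θ hθ hne)
  · exact fun η hη => (exists_measure_lt_mean_sq_obs_le hY hobs hη).imp fun B hB =>
      Eventually.of_forall hB
  · intro B θ hθ δ hδ
    refine ⟨_, hK.eventually_negLogLik_sub_le hΘ hθ (ρ := 1 - 2 * |ε|) (by linarith) hδ B,
      (eventually_gt_atTop 0).mono fun n hn => ?_⟩
    filter_upwards [hseparated] with ω hω hB θ' hθ'
    exact hθ'.1 n (fun i : Fin n => v i) (fun i : Fin n => obsPoint v ε (X · ω.1) i)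
      (obs v ε X Y n ω) hn (hω n) hB

theorem mainTheorem3 {d p : ℕ} (hd : 1 ≤ d) (a b : ℝ)
    -- the parametric model and the true parameter, interior to the parameter set `[a, b]^p`
    (K : (Fin p → ℝ) → EuclideanSpace ℝ (Fin d) → ℝ)
    (hK : PerturbedGrid.RegularModel a b K)
    (θ₀ : Fin p → ℝ) (hθ₀ : ∀ i, a < θ₀ i ∧ θ₀ i < b)
    -- the grid, the regularity parameter and the law of the perturbations
    (v : ℕ → Fin d → ℤ) (hv : PerturbedGrid.IsGridSequence v)
    (ε : ℝ) (hε₀ : 0 ≤ ε) (hε : ε < 1 / 2)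
    (L : Measure (EuclideanSpace ℝ (Fin d))) (hL : PerturbedGrid.IsPerturbationLaw L)
    -- the iid perturbations
    {ΩX : Type*} [MeasurableSpace ΩX] (PX : Measure ΩX) [IsProbabilityMeasure PX]
    (X : ℕ → ΩX → EuclideanSpace ℝ (Fin d)) (hXmeas : ∀ i, Measurable (X i))
    (hXindep : iIndepFun X PX) (hXlaw : ∀ i, PX.map (X i) = L)
    -- the centered stationary Gaussian process with covariance function `K θ₀`
    {ΩY : Type*} [MeasurableSpace ΩY] (PY : Measure ΩY) [IsProbabilityMeasure PY]
    (Y : EuclideanSpace ℝ (Fin d) → ΩY → ℝ) (hY : IsGaussianProcess Y PY)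
    (hYmean : ∀ t, ∫ ω, Y t ω ∂PY = 0)
    (hYcov : ∀ s t, covariance (Y s) (Y t) PY = K θ₀ (s - t))
    -- the observations are random variables on the product space
    (hobs : ∀ n, AEMeasurable (PerturbedGrid.obs v ε X Y n) (PX.prod PY))
    -- any maximum likelihood estimator
    (T : ℕ → ΩX × ΩY → Fin p → ℝ)
    (hT : PerturbedGrid.IsMLEstimator (PX.prod PY) a b K v ε X Y T) :
    (ε = 0 →
      (¬ ∃ θ ∈ PerturbedGrid.paramSet p a b, θ ≠ θ₀ ∧
        ∀ u : Fin d → ℤ,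
          K θ (PerturbedGrid.latticePoint u) = K θ₀ (PerturbedGrid.latticePoint u)) →
      TendstoInMeasure (PX.prod PY) T atTop (fun _ => θ₀)) ∧
    (ε ≠ 0 →
      (¬ ∃ θ ∈ PerturbedGrid.paramSet p a b, θ ≠ θ₀ ∧
        (∀ᵐ t ∂(volume.restrict (PerturbedGrid.diffSet L.support ε)), K θ t = K θ₀ t) ∧
        K θ 0 = K θ₀ 0) →
      TendstoInMeasure (PX.prod PY) T atTop (fun _ => θ₀)) := by
  have hθ₀' : θ₀ ∈ PerturbedGrid.paramSet p a b := ⟨fun i => (hθ₀ i).1.le, fun i => (hθ₀ i).2.le⟩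
  have consistent := mainTheorem3_general hd isCompact_Icc hK.spectralModel hθ₀' hv
    (by rwa [abs_of_nonneg hε₀]) hL.support_subset
    (fun i => ⟨(hXmeas i).aemeasurable, hXlaw i⟩) hXindep ⟨hY, hYmean, hYcov⟩ hobs hT
  have hcont {θ} (hθ : θ ∈ PerturbedGrid.paramSet p a b) : Continuous (K θ) :=
    hK.spectralModel.continuous_kernel hθ
  refine ⟨fun _ hid => consistent fun θ hθ hne => ?_, fun _ hid => consistent fun θ hθ hne => ?_⟩
  · by_contra! heq
    have := hL.prob
    have hsupport := Measure.nonempty_support (IsProbabilityMeasure.ne_zero L)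
    exact hid ⟨θ, hθ, hne, fun u =>
      heq _ (PerturbedGrid.latticePoint_mem_insert_diffSet hsupport ε u)⟩
  · by_contra! heq
    refine hid ⟨θ, hθ, hne, ?_, heq 0 (Set.mem_insert _ _)⟩
    exact (ae_restrict_iff (isClosed_eq (hcont hθ) (hcont hθ₀')).measurableSet).2
      (ae_of_all _ fun t ht => heq t (Set.mem_insert_of_mem _ ht))
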